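/- Let $E=(E^0,E^1,r,s)$ be a finite directed graph with no sinks and no sources (every vertex emits and receives an edge); paths are words $e_1e_2\cdots$ with $s(e_i)=r(e_{i+1})$, and $vE^*$ is the set of finite paths with range $v$. Let $G$ be a groupoid with unit space $E^0$, with domain and codomain maps $d,c$, and let $(G,E)$ be a self-similar groupoid action: $G$ acts faithfully on $E^*$ by length-preserving bijections $g : d(g)E^*\to c(g)E^*$ with $g\cdot(\mu e)\in (g\cdot\mu)E^1$, and for all $g\in G$, $e\in d(g)E^1$ there is a (unique) $g|_e\in G$ with domain $s(e)$ and codomain $s(g\cdot e)$ such that $g\cdot(e\mu)=(g\cdot e)(g|_e\cdot\mu)$ for all $\mu\in s(e)E^*$. Put $g|_{d(g)}=g$ and $g|_{e\mu}=(g|_e)|_\mu$. Assume that $(G,E)$ is * contracting: there is a finite $F\subseteq G$ such that for every $g\in G$ there is $n\ge 0$ with $g|_\mu\in F$ for all $\mu\in d(g)E^n$; and * regular: whenever $g\in G$ and $y\in E^\infty$ satisfy $g\cdot y=y$, there is a finite initial segment $\mu$ of $y$ with $g\cdot\mu=\mu$ and $g|_\mu=s(\mu)$. Let $\mathcal J=E^{-\infty}/{\sim}$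 be the limit space, where $x\sim y$ if there is a sequence $(g_n)_{n<0}$ in $G$ with finitely many distinct terms and $g_n\cdot x_n\cdots x_{-1}=y_n\cdots y_{-1}$ for all $n<0$. Let $\mathcal S=E^{\mathbb Z}/{\sim}$ be the limit solenoid, where $x\sim y$ if there is a family $(g_n)_{n\in\mathbb Z}$ in $G$ with finitely many distinct terms and $g_n\cdot x_nx_{n+1}\cdots=y_ny_{n+1}\cdots$ for all $n\in\mathbb Z$. Both carry the quotients of the cylinder-set topologies. Let $\tilde\sigma:\mathcal J\to\mathcal J$, $\tilde\sigma([\cdots x_{-2}x_{-1}])=[\cdots x_{-3}x_{-2}]$; let $\tilde\tau:\mathcal S\to\mathcal S$ be the homeomorphism $\tilde\tau([x])=[(x_{n-1})_{n}]$; and let $\tilde\pi:\mathcal S\to\mathcal J$, $\tilde\pi([x])=[\cdots x_{-2}x_{-1}]$. The dual groupoid $\widehat{\mathcal G}_{G,E}$ is the Deaconu--Renault groupoid of $(\mathcal J,\tilde\sigma)$: the set of triples $(x,m-n,y)\in\mathcal J\times\mathbb Z\times\mathcal J$ with $m,n\in\mathbb N_0$ and $\tilde\sigma^m(x)=\tilde\sigma^n(y)$,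 with $(x,p,y)(y,q,z)=(x,p+q,z)$ and $(x,p,y)^{-1}=(y,-p,x)$, and with the topology generated by the sets $\{(x,m-n,y): x\in U,\ y\in V,\ \tilde\sigma^m(x)=\tilde\sigma^n(y)\}$ for $m,n\in\mathbb N_0$ and $U,V\subseteq\mathcal J$ open. Its amplification by $\tilde\pi$ is $\widehat{\mathcal G}^{\tilde\pi}_{G,E}=\{(\xi,\gamma,\eta)\in\mathcal S\times\widehat{\mathcal G}_{G,E}\times\mathcal S: r(\gamma)=\tilde\pi(\xi),\ s(\gamma)=\tilde\pi(\eta)\}$ with the subspace topology from the product and $(\xi,\gamma,\eta)(\eta,\gamma',\zeta)=(\xi,\gamma\gamma',\zeta)$. For a metric $d$ on $\mathcal S$ inducing its topology, let $G^s=\{(\xi,\eta)\in\mathcal S\times\mathcal S: d(\tilde\tau^m(\xi),\tilde\tau^m(\eta))\to0\text{ as }m\to\infty\}$, and for $\varepsilon>0$, $M\in\mathbb N_0$ let $G^s_{\varepsilon,M}=\{(\xi,\eta): d(\tilde\tau^m(\xi),\tilde\tau^m(\eta))<\varepsilon\text{ for all }m\ge M\}$. Give $G^s$ the inductive limit topology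 for the sets $G^s\cap G^s_{\varepsilon,M}$, $M\in\mathbb N_0$, with the subspace topologies from $\mathcal S\times\mathcal S$. The stable Ruelle groupoid is $G^s\rtimes_{\tilde\tau}\mathbb Z=\{(\xi,n,\eta)\in\mathcal S\times\mathbb Z\times\mathcal S:(\tilde\tau^n(\xi),\eta)\in G^s\}$, with $(\xi,n,\eta)(\eta,m,\zeta)=(\xi,n+m,\zeta)$ and $(\xi,n,\eta)^{-1}=(\eta,-n,\xi)$, topologised by identifying $(\xi,n,\eta)$ with $((\tilde\tau^n(\xi),\eta),n)\in G^s\times\mathbb Z$. Then $\mathcal J$ and $\mathcal S$ are compact and metrisable, $\tilde\sigma$ is a local homeomorphism, $\tilde\pi$ is a continuous open surjection, and $\widehat{\mathcal G}^{\tilde\pi}_{G,E}$ is a topological groupoid. Moreover, for every metric $d$ on $\mathcal S$ inducing its topology there is $\varepsilon_0>0$ such that for all $0<\varepsilon\le\varepsilon_0$: $G^s=\bigcup_M G^s_{\varepsilon,M}$, the stable Ruelle groupoid $G^s\rtimes_{\tilde\tau}\mathbb Z$ is a topological groupoid, and there is an isomorphism of topological groupoids $$\kappa:G^s\rtimes_{\tilde\tau}\mathbb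 Z\to\widehat{\mathcal G}^{\tilde\pi}_{G,E},\qquad \kappa(\xi,n,\eta)=(\xi,(\tilde\pi(\xi),n,\tilde\pi(\eta)),\eta).$$ -/

import Mathlib

open Topology

universe u v w

/-! ## Directed graphs and their paths -/

/-- A directed graph with vertex set `V` and edge set `A`; the edge `e` points from `s e` to
`r e`. -/
structure DirGraph (V : Type u) (A : Type v) where
  r : A → V
  s : A → V

namespace DirGraph

variable {V : Type u} {A : Type v} (E : DirGraph V A)

/-- Every vertex receives an edge. -/
def NoSources : Prop := ∀ x : V, ∃ e : A, E.r e = x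

/-- Every vertex emits an edge. -/
def NoSinks : Prop := ∀ x : V, ∃ e : A, E.s e = x

/-- `E.IsPath x [e₁, …, eₙ]`: the word `e₁ ⋯ eₙ` is a path of `E` with range `x`, that is,
`r e₁ = x` and `s eᵢ = r eᵢ₊₁`. The empty word stands for the path `x` of length `0`. -/
def IsPath : V → List A → Prop
  | _, [] => True
  | x, e :: l => E.r e = x ∧ IsPath (E.s e) l

/-- The source of a path with range `x`. -/
def src : V → List A → V
  | x, [] => x
  | _, e :: l => src (E.s e) l

/-- The set `xE^*` of finite paths with range `x`. -/
abbrev PathFrom (x : V) : Type v := {l : List A // E.IsPath x l}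

/-- Right-infinite paths `x₁ x₂ x₃ ⋯`; the edge `xₙ₊₁` is stored at index `n`. -/
abbrev RightPath : Type v := {x : ℕ → A // ∀ n, E.s (x n) = E.r (x (n + 1))}

/-- Left-infinite paths `⋯ x₋₃ x₋₂ x₋₁`; the edge `x₋₍ₙ₊₁₎` is stored at index `n`. -/
@[ext] structure LeftPath : Type v where
  edge : ℕ → A
  chain : ∀ n, E.s (edge (n + 1)) = E.r (edge n)

/-- Bi-infinite paths. -/
@[ext] structure BiPath : Type v where
  edge : ℤ → A
  chain : ∀ n, E.s (edge n) = E.r (edge (n + 1))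

/-- The topology of cylinder sets on `E^{-∞}`: the subspace topology from the product of discrete
spaces. -/
instance : TopologicalSpace E.LeftPath :=
  TopologicalSpace.induced LeftPath.edge (@Pi.topologicalSpace ℕ (fun _ => A) (fun _ => ⊥))

/-- The topology of cylinder sets on `E^ℤ`. -/
instance : TopologicalSpace E.BiPath :=
  TopologicalSpace.induced BiPath.edge (@Pi.topologicalSpace ℤ (fun _ => A) (fun _ => ⊥))

/-- The first `n` letters of a sequence. -/
def initial : (ℕ → A) → ℕ → List A
  | _, 0 => []
  | x, n + 1 => x 0 :: initial (fun k => x (k + 1)) n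

variable {E}

/-- The word `x₋ₙ ⋯ x₋₁` of a left-infinite path. -/
def LeftPath.lastWord (x : E.LeftPath) : ℕ → List A
  | 0 => []
  | n + 1 => x.1 n :: x.lastWord n

/-- The right-infinite path `xₙ xₙ₊₁ xₙ₊₂ ⋯` of a bi-infinite path. -/
def BiPath.tail (x : E.BiPath) (n : ℤ) : E.RightPath :=
  ⟨fun k => x.1 (n + k), fun k => by
    have h : n + k + 1 = n + (k + 1 : ℕ) := by push_cast; ring
    exact (x.2 (n + k)).trans (congrArg (fun i => E.r (x.1 i)) h)⟩

/-- The left-infinite path `⋯ x₋₃ x₋₂ x₋₁` of a bi-infinite path. -/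
def BiPath.left (x : E.BiPath) : E.LeftPath :=
  ⟨fun n => x.1 (-((n + 1 : ℕ) : ℤ)), fun n => by
    have h : -((n + 1 + 1 : ℕ) : ℤ) + 1 = -((n + 1 : ℕ) : ℤ) := by push_cast; ring
    exact (x.2 (-((n + 1 + 1 : ℕ) : ℤ))).trans (congrArg (fun i => E.r (x.1 i)) h)⟩

/-- The shift `σ(⋯ x₋₃ x₋₂ x₋₁) = ⋯ x₋₃ x₋₂`. -/
def LeftPath.shift (x : E.LeftPath) : E.LeftPath :=
  ⟨fun n => x.1 (n + 1), fun n => x.2 (n + 1)⟩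

/-- The translation `(x_n)_n ↦ (x_{n+k})_n` of bi-infinite paths. -/
def BiPath.translate (k : ℤ) (x : E.BiPath) : E.BiPath :=
  ⟨fun n => x.1 (n + k), fun n => by
    have h : n + k + 1 = n + 1 + k := by ring
    exact (x.2 (n + k)).trans (congrArg (fun i => E.r (x.1 i)) h)⟩

lemma continuous_translate (k : ℤ) : Continuous (BiPath.translate (E := E) k) := by
  let _ : TopologicalSpace A := ⊥
  refine continuous_induced_rng.2 (continuous_pi fun n => ?_)
  exact (continuous_apply (n + k)).comp continuous_induced_dom

lemma isPath_initial (x : ℕ → A) (h : ∀ n, E.s (x n) = E.r (x (n + 1))) (n : ℕ) :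
    E.IsPath (E.r (x 0)) (initial x n) := by
  induction n generalizing x with
  | zero => trivial
  | succ n ih =>
    refine ⟨rfl, ?_⟩
    have := ih (fun k => x (k + 1)) (fun k => h (k + 1))
    rwa [h 0]

lemma LeftPath.isPath_lastWord (x : E.LeftPath) (n : ℕ) :
    E.IsPath (E.r (x.1 n)) (x.lastWord (n + 1)) := by
  induction n with
  | zero => exact ⟨rfl, trivial⟩
  | succ n ih => exact ⟨rfl, by rw [x.2 n]; exact ih⟩

lemma LeftPath.lastWord_shift (x : E.LeftPath) (n : ℕ) :
    x.lastWord (n + 1) = x.shift.lastWord n ++ [x.1 0] := by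
  induction n with
  | zero => rfl
  | succ n ih =>
    have h : x.lastWord (n + 1 + 1) = x.1 (n + 1) :: x.lastWord (n + 1) := rfl
    rw [h, ih]; rfl

lemma BiPath.lastWord_left (x : E.BiPath) (n : ℕ) :
    x.left.lastWord n = initial (x.tail (-(n : ℤ))).1 n := by
  have key : ∀ n : ℕ, x.left.lastWord n = initial (fun k : ℕ => x.1 (-(n : ℤ) + k)) n := by
    intro n
    induction n with
    | zero => rfl
    | succ n ih =>
      have h : x.left.lastWord (n + 1) = x.1 (-((n + 1 : ℕ) : ℤ)) :: x.left.lastWord n := rfl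
      have e0 : -((n + 1 : ℕ) : ℤ) = -((n + 1 : ℕ) : ℤ) + (0 : ℕ) := by simp
      have e1 : (fun k : ℕ => x.1 (-(n : ℤ) + k)) =
          fun k : ℕ => x.1 (-((n + 1 : ℕ) : ℤ) + (k + 1 : ℕ)) :=
        funext fun k => congrArg x.1 (by push_cast; ring)
      rw [h, ih, initial, ← e0, e1]
  exact key n

lemma IsPath.prefix {x : V} {l l' : List A} (h : E.IsPath x (l ++ l')) : E.IsPath x l := by
  induction l generalizing x with
  | nil => trivial
  | cons e l ih => exact ⟨h.1, ih h.2⟩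

/-! ## Partial isomorphisms and self-similar groupoid actions -/

variable (E) in
/-- Partial isomorphisms `xE^* → yE^*` of the path space: length-preserving bijections `g` such
that `g(μe) ∈ g(μ)E¹`. -/
@[ext] structure PIso (x y : V) where
  toEquiv : E.PathFrom x ≃ E.PathFrom y
  length_eq : ∀ μ, (toEquiv μ).1.length = μ.1.length
  concat : ∀ (μ ν : E.PathFrom x) (e : A), ν.1 = μ.1 ++ [e] →
    ∃ f : A, (toEquiv ν).1 = (toEquiv μ).1 ++ [f]

end DirGraph

/-- The arrows of a groupoid with unit space `V`. The arrow `⟨x, y, g⟩` has domain `d(g) = x` and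
codomain `c(g) = y`. -/
abbrev GArrow (V : Type u) [CategoryTheory.Groupoid.{w} V] : Type (max u w) :=
  Σ x y : V, (x ⟶ y)

/-- The unit at the vertex `x`. -/
def GArrow.unit {V : Type u} [CategoryTheory.Groupoid.{w} V] (x : V) : GArrow V :=
  ⟨x, x, CategoryTheory.CategoryStruct.id x⟩

open CategoryTheory in
/-- A self-similar action on the graph `E` of a groupoid `G` with unit space `V = E⁰`: an injective
groupoid homomorphism from `G` into the partial isomorphisms of `E^*`, the identity on units, such
that for all `g ∈ G` and `e ∈ d(g)E¹` there are an edge `f` (which is `g · e`) and `h ∈ G` with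
domain `s(e)` and codomain `s(g · e)` with `g · (eμ) = (g · e)(h · μ)` for all `μ ∈ s(e)E^*`. -/
structure SelfSimilarAction {V : Type u} {A : Type v} (E : DirGraph V A)
    [CategoryTheory.Groupoid.{w} V] where
  act : ∀ {x y : V}, (x ⟶ y) → E.PIso x y
  act_id : ∀ x : V, (act (𝟙 x)).toEquiv = Equiv.refl _
  act_comp : ∀ {x y z : V} (g : x ⟶ y) (h : y ⟶ z),
    (act (g ≫ h)).toEquiv = (act g).toEquiv.trans (act h).toEquiv
  faithful : ∀ x y : V, Function.Injective (act : (x ⟶ y) → E.PIso x y)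
  selfSimilar : ∀ {x y : V} (g : x ⟶ y) (e : A) (he : E.r e = x),
    ∃ (f : A) (h : E.s e ⟶ E.s f), ∀ μ : E.PathFrom (E.s e),
      ((act g).toEquiv ⟨e :: μ.1, he, μ.2⟩).1 = f :: ((act h).toEquiv μ).1

namespace SelfSimilarAction

open DirGraph CategoryTheory

variable {V : Type u} {A : Type v} {E : DirGraph V A} [CategoryTheory.Groupoid.{w} V]
variable (S : SelfSimilarAction E)

/-- `g · e` for an edge `e ∈ d(g)E¹`. -/
noncomputable def actEdge {x y : V} (g : x ⟶ y) (e : A) (he : E.r e = x) : A :=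
  (S.selfSimilar g e he).choose

/-- The restriction `g|_e` for an edge `e ∈ d(g)E¹`, with domain `s(e)` and codomain `s(g · e)`;
by faithfulness it is uniquely determined. -/
noncomputable def restrEdge {x y : V} (g : x ⟶ y) (e : A) (he : E.r e = x) :
    E.s e ⟶ E.s (S.actEdge g e he) :=
  (S.selfSimilar g e he).choose_spec.choose

/-- The restriction `g|_μ` for a path `μ ∈ d(g)E^*`: `g|_{d(g)} = g` and
`g|_{eμ} = (g|_e)|_μ`. -/
noncomputable def restr : (μ : List A) → (g : GArrow V) → E.IsPath g.1 μ → GArrow V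
  | [], g, _ => g
  | e :: μ, g, h => restr μ ⟨_, _, S.restrEdge g.2.2 e h.1⟩ h.2

/-- `S.Acts g μ ν`: the path `μ` has range `d(g)`, and `g · μ = ν`. -/
def Acts (g : GArrow V) (μ ν : List A) : Prop :=
  ∃ h : E.IsPath g.1 μ, ((S.act g.2.2).toEquiv ⟨μ, h⟩).1 = ν

/-- `S.ActsInf g x y`: the right-infinite path `x` has range `d(g)`, and `g · x = y`, where `g · x`
is the infinite path whose initial segments are the images under `g` of those of `x`. -/
def ActsInf (g : GArrow V) (x y : E.RightPath) : Prop :=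
  ∀ n : ℕ, S.Acts g (initial x.1 n) (initial y.1 n)

/-- There is a finite set `F` of arrows such that for every `g` there is `n` with
`g|_μ ∈ F` for all `μ ∈ d(g)E^n`. -/
def Contracting : Prop :=
  ∃ F : Set (GArrow V), F.Finite ∧
    ∀ g : GArrow V, ∃ n : ℕ, ∀ (μ : List A) (h : E.IsPath g.1 μ), μ.length = n → S.restr μ g h ∈ F

/-- Whenever `g · y = y` for a right-infinite path `y`, there is an initial segment `μ` of `y` with
`g · μ = μ` and `g|_μ = s(μ)`. -/
def Regular : Prop :=
  ∀ (g : GArrow V) (y : E.RightPath), S.ActsInf g y y →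
    ∃ (n : ℕ) (h : E.IsPath g.1 (initial y.1 n)), S.Acts g (initial y.1 n) (initial y.1 n) ∧
      S.restr (initial y.1 n) g h = GArrow.unit (E.src g.1 (initial y.1 n))

/-- Asymptotic equivalence of left-infinite paths: there is a sequence `(g_n)` in `G` with finitely
many values such that `g_n · x₋₍ₙ₊₁₎ ⋯ x₋₁ = y₋₍ₙ₊₁₎ ⋯ y₋₁` for all `n`. -/
def AsympLeft (x y : E.LeftPath) : Prop :=
  ∃ g : ℕ → GArrow V, (Set.range g).Finite ∧
    ∀ n, S.Acts (g n) (x.lastWord (n + 1)) (y.lastWord (n + 1))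

/-- Asymptotic equivalence of bi-infinite paths: there is a family `(g_n)_{n ∈ ℤ}` in `G` with
finitely many values such that `g_n · x_n x_{n+1} ⋯ = y_n y_{n+1} ⋯` for all `n`. -/
def AsympBi (x y : E.BiPath) : Prop :=
  ∃ g : ℤ → GArrow V, (Set.range g).Finite ∧ ∀ n, S.ActsInf (g n) (x.tail n) (y.tail n)

/-! ### Asymptotic equivalence is an equivalence relation -/

lemma acts_unit {x : V} {μ : List A} (h : E.IsPath x μ) : S.Acts (GArrow.unit x) μ μ := by
  refine ⟨h, ?_⟩
  have := S.act_id x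
  simp only [GArrow.unit]
  rw [this]; rfl

/-- The inverse arrow. -/
def invArrow (g : GArrow V) : GArrow V := ⟨g.2.1, g.1, Groupoid.inv g.2.2⟩

open Classical in
/-- The product `hg` (first `g`, then `h`) if it is defined, and `g` otherwise. -/
noncomputable def compArrow (g h : GArrow V) : GArrow V :=
  if hh : g.2.1 = h.1 then ⟨g.1, h.2.1, g.2.2 ≫ eqToHom hh ≫ h.2.2⟩ else g

variable {S}

lemma Acts.inv {g : GArrow V} {μ ν : List A} (h : S.Acts g μ ν) : S.Acts (invArrow g) ν μ := by
  obtain ⟨h, rfl⟩ := h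
  refine ⟨((S.act g.2.2).toEquiv ⟨μ, h⟩).2, ?_⟩
  have h1 := S.act_comp g.2.2 (Groupoid.inv g.2.2)
  rw [Groupoid.comp_inv, S.act_id] at h1
  have h2 := congrArg (fun f => (f ⟨μ, h⟩).1) h1
  exact h2.symm

lemma Acts.comp {g h : GArrow V} {e e' e'' : A} {μ ν ρ : List A}
    (h1 : S.Acts g (e :: μ) (e' :: ν)) (h2 : S.Acts h (e' :: ν) (e'' :: ρ)) :
    S.Acts (compArrow g h) (e :: μ) (e'' :: ρ) := by
  obtain ⟨x, y, g⟩ := g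
  obtain ⟨y', z, h⟩ := h
  obtain ⟨p, hp⟩ := h1
  obtain ⟨q, hq⟩ := h2
  have hy : y = y' := by
    have h3 := ((S.act g).toEquiv ⟨e :: μ, p⟩).2
    simp only at hp
    rw [hp] at h3
    exact h3.1.symm.trans q.1
  subst hy
  have h3 : compArrow (⟨x, y, g⟩ : GArrow V) ⟨y, z, h⟩ = ⟨x, z, g ≫ h⟩ := by
    simp [compArrow]
  rw [h3]
  refine ⟨p, ?_⟩
  simp only [S.act_comp, Equiv.trans_apply]
  rw [← hq]
  congr 2
  exact Subtype.ext hp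

lemma Acts.dropLast {g : GArrow V} {μ ν : List A} {e f : A}
    (h : S.Acts g (μ ++ [e]) (ν ++ [f])) : S.Acts g μ ν := by
  obtain ⟨p, hp⟩ := h
  refine ⟨p.prefix, ?_⟩
  obtain ⟨f', hf⟩ := (S.act g.2.2).concat ⟨μ, p.prefix⟩ ⟨μ ++ [e], p⟩ e rfl
  rw [hp] at hf
  exact (List.append_inj' hf rfl).1.symm

lemma ActsInf.inv {g : GArrow V} {x y : E.RightPath} (h : S.ActsInf g x y) :
    S.ActsInf (invArrow g) y x := fun n => (h n).inv

lemma ActsInf.comp {g h : GArrow V} {x y z : E.RightPath} (h1 : S.ActsInf g x y)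
    (h2 : S.ActsInf h y z) : S.ActsInf (compArrow g h) x z := by
  have pos : ∀ n, S.Acts (compArrow g h) (initial x.1 (n + 1)) (initial z.1 (n + 1)) :=
    fun n => (h1 (n + 1)).comp (h2 (n + 1))
  intro n
  cases n with
  | zero =>
    refine ⟨trivial, ?_⟩
    exact List.length_eq_zero_iff.1 ((S.act _).length_eq _)
  | succ n => exact pos n

lemma finite_compArrow {ι : Type*} {g h : ι → GArrow V} (hg : (Set.range g).Finite)
    (hh : (Set.range h).Finite) : (Set.range fun i => compArrow (g i) (h i)).Finite := by
  refine (Set.Finite.image2 compArrow hg hh).subset ?_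
  rintro _ ⟨i, rfl⟩
  exact ⟨_, ⟨i, rfl⟩, _, ⟨i, rfl⟩, rfl⟩

lemma finite_invArrow {ι : Type*} {g : ι → GArrow V} (hg : (Set.range g).Finite) :
    (Set.range fun i => invArrow (g i)).Finite := by
  refine (hg.image invArrow).subset ?_
  rintro _ ⟨i, rfl⟩
  exact ⟨_, ⟨i, rfl⟩, rfl⟩

lemma finite_unit [Finite V] {ι : Type*} (f : ι → V) :
    (Set.range fun i => GArrow.unit (f i)).Finite := by
  refine (Set.finite_range (GArrow.unit : V → GArrow V)).subset ?_
  rintro _ ⟨i, rfl⟩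
  exact ⟨_, rfl⟩

lemma AsympLeft.shift {x y : E.LeftPath} (h : S.AsympLeft x y) :
    S.AsympLeft x.shift y.shift := by
  obtain ⟨g, hg, h⟩ := h
  refine ⟨fun n => g (n + 1), hg.subset ?_, fun n => ?_⟩
  · rintro _ ⟨n, rfl⟩
    exact ⟨n + 1, rfl⟩
  · have h1 := h (n + 1)
    rw [x.lastWord_shift, y.lastWord_shift] at h1
    exact h1.dropLast

lemma AsympBi.left {x y : E.BiPath} (h : S.AsympBi x y) : S.AsympLeft x.left y.left := by
  obtain ⟨g, hg, h⟩ := h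
  refine ⟨fun n => g (-((n + 1 : ℕ) : ℤ)), hg.subset ?_, fun n => ?_⟩
  · rintro _ ⟨n, rfl⟩
    exact ⟨_, rfl⟩
  · rw [x.lastWord_left, y.lastWord_left]
    exact h _ _

lemma AsympBi.translate (k : ℤ) {x y : E.BiPath} (h : S.AsympBi x y) :
    S.AsympBi (x.translate k) (y.translate k) := by
  obtain ⟨g, hg, h⟩ := h
  refine ⟨fun n => g (n + k), hg.subset ?_, fun n => ?_⟩
  · rintro _ ⟨n, rfl⟩
    exact ⟨_, rfl⟩
  · have e : ∀ z : E.BiPath, (z.translate k).tail n = z.tail (n + k) := fun z =>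
      Subtype.ext (funext fun j => congrArg z.1 (by ring))
    rw [e, e]
    exact h _

variable (S)

lemma asympLeft_equivalence [Finite V] : Equivalence S.AsympLeft where
  refl x := ⟨fun n => GArrow.unit (E.r (x.1 n)), finite_unit _,
    fun n => S.acts_unit (x.isPath_lastWord n)⟩
  symm := fun ⟨g, hg, h⟩ => ⟨fun n => invArrow (g n), finite_invArrow hg, fun n => (h n).inv⟩
  trans := fun ⟨g, hg, h⟩ ⟨g', hg', h'⟩ =>
    ⟨fun n => compArrow (g n) (g' n), finite_compArrow hg hg', fun n => (h n).comp (h' n)⟩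

lemma asympBi_equivalence [Finite V] : Equivalence S.AsympBi where
  refl x := ⟨fun n => GArrow.unit (E.r ((x.tail n).1 0)), finite_unit _,
    fun n k => S.acts_unit (isPath_initial _ (x.tail n).2 k)⟩
  symm := fun ⟨g, hg, h⟩ => ⟨fun n => invArrow (g n), finite_invArrow hg, fun n => (h n).inv⟩
  trans := fun ⟨g, hg, h⟩ ⟨g', hg', h'⟩ =>
    ⟨fun n => compArrow (g n) (g' n), finite_compArrow hg hg', fun n => (h n).comp (h' n)⟩

/-! ## The limit space and the limit solenoid -/

variable [Finite V]

/-- Asymptotic equivalence on `E^{-∞}`. -/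
def leftSetoid : Setoid E.LeftPath := ⟨S.AsympLeft, S.asympLeft_equivalence⟩

/-- Asymptotic equivalence on `E^ℤ`. -/
def biSetoid : Setoid E.BiPath := ⟨S.AsympBi, S.asympBi_equivalence⟩

/-- The limit space `J`, the quotient of `E^{-∞}` by asymptotic equivalence, with the quotient
topology. -/
abbrev LimitSpace : Type v := Quotient S.leftSetoid

/-- The limit solenoid, the quotient of `E^ℤ` by asymptotic equivalence, with the quotient
topology. -/
abbrev Solenoid : Type v := Quotient S.biSetoid

/-- The map `σ̃` on the limit space with `σ̃([x]) = [σ(x)]`. -/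
def shiftJ : S.LimitSpace → S.LimitSpace :=
  Quotient.map (sa := S.leftSetoid) (sb := S.leftSetoid) LeftPath.shift
    (fun _ _ h => AsympLeft.shift h)

/-- The map `π̃` from the solenoid to the limit space with `π̃([x]) = [⋯ x₋₃ x₋₂ x₋₁]`. -/
def proj : S.Solenoid → S.LimitSpace :=
  Quotient.map (sa := S.biSetoid) (sb := S.leftSetoid) BiPath.left (fun _ _ h => AsympBi.left h)

/-- The map of the solenoid induced by the translation by `k`. -/
def translateS (k : ℤ) : S.Solenoid → S.Solenoid :=
  Quotient.map (sa := S.biSetoid) (sb := S.biSetoid) (BiPath.translate k)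
    (fun _ _ h => AsympBi.translate k h)

lemma continuous_translateS (k : ℤ) : Continuous (S.translateS k) :=
  Continuous.quotient_map' (s := S.biSetoid) (t := S.biSetoid) (continuous_translate k)
    (fun _ _ h => AsympBi.translate k h)

lemma translateS_translateS {k l : ℤ} (h : k + l = 0) (ξ : S.Solenoid) :
    S.translateS k (S.translateS l ξ) = ξ := by
  refine Quotient.inductionOn (s := S.biSetoid) ξ fun x => ?_
  refine congrArg (Quotient.mk S.biSetoid) (BiPath.ext (funext fun n => congrArg x.1 ?_))
  linarith

/-- The homeomorphism `τ̃` of the solenoid with `τ̃([x]) = [τ(x)]`, where `τ(x)_n = x_{n-1}`. -/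
def tau : S.Solenoid ≃ₜ S.Solenoid where
  toFun := S.translateS (-1)
  invFun := S.translateS 1
  left_inv := S.translateS_translateS (by norm_num)
  right_inv := S.translateS_translateS (by norm_num)
  continuous_toFun := S.continuous_translateS _
  continuous_invFun := S.continuous_translateS _

end SelfSimilarAction

/-! ## Groupoids given by their arrows, and their isomorphisms -/

/-- A groupoid with unit space `X` and set of arrows `Γ`. -/
structure ArrowGroupoid (X : Type u) (Γ : Type v) where
  r : Γ → X
  s : Γ → X
  unit : X → Γ
  mul : ∀ a b : Γ, s a = r b → Γ
  inv : Γ → Γ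
  r_unit : ∀ x, r (unit x) = x
  s_unit : ∀ x, s (unit x) = x
  r_mul : ∀ a b h, r (mul a b h) = r a
  s_mul : ∀ a b h, s (mul a b h) = s b
  r_inv : ∀ a, r (inv a) = s a
  s_inv : ∀ a, s (inv a) = r a
  mul_assoc : ∀ a b c (h : s a = r b) (h' : s b = r c),
    mul (mul a b h) c ((s_mul a b h).trans h') = mul a (mul b c h') (h.trans (r_mul b c h').symm)
  unit_mul : ∀ a, mul (unit (r a)) a (s_unit (r a)) = a
  mul_unit : ∀ a, mul a (unit (s a)) (r_unit (s a)).symm = a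
  inv_mul : ∀ a, mul (inv a) a (s_inv a) = unit (s a)
  mul_inv : ∀ a, mul a (inv a) (r_inv a).symm = unit (r a)

/-- All structure maps are continuous; the set of composable pairs carries the subspace topology
from `Γ × Γ`. -/
structure ArrowGroupoid.IsTopological {X : Type u} {Γ : Type v} [TopologicalSpace X]
    [TopologicalSpace Γ] (G : ArrowGroupoid X Γ) : Prop where
  continuous_r : Continuous G.r
  continuous_s : Continuous G.s
  continuous_unit : Continuous G.unit
  continuous_inv : Continuous G.inv
  continuous_mul : Continuous fun p : {p : Γ × Γ // G.s p.1 = G.r p.2} => G.mul p.1.1 p.1.2 p.2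

/-- Isomorphisms of topological groupoids: homeomorphisms of the arrow spaces and of the unit
spaces that respect range, source and multiplication (hence also units and inverses). -/
structure TopGroupoidIso {X Y Γ Δ : Type*} [TopologicalSpace X] [TopologicalSpace Y]
    [TopologicalSpace Γ] [TopologicalSpace Δ] (G : ArrowGroupoid X Γ) (H : ArrowGroupoid Y Δ) where
  onArrows : Γ ≃ₜ Δ
  onUnits : X ≃ₜ Y
  map_r : ∀ a, H.r (onArrows a) = onUnits (G.r a)
  map_s : ∀ a, H.s (onArrows a) = onUnits (G.s a)
  map_mul : ∀ (a b : Γ) (h : G.s a = G.r b), onArrows (G.mul a b h) =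
    H.mul (onArrows a) (onArrows b) ((map_s a).trans ((congrArg onUnits h).trans (map_r b).symm))

/-! ## Deaconu–Renault groupoids -/

/-- The arrows `(x, k, y)` with `k = m - n` and `T^m(x) = T^n(y)` for some `m, n ∈ ℕ`. -/
@[ext] structure DeaconuRenault {X : Type u} (T : X → X) where
  rng : X
  lag : ℤ
  src : X
  cond : ∃ m n : ℕ, lag = (m : ℤ) - n ∧ T^[m] rng = T^[n] src

namespace DeaconuRenault

variable {X : Type u} {T : X → X}

/-- The set `Z(U, m, n, V)` of all `(x, m - n, y)` with `x ∈ U`, `y ∈ V` and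
`T^m(x) = T^n(y)`. -/
def basicSet (U : Set X) (m n : ℕ) (W : Set X) : Set (DeaconuRenault T) :=
  {g | g.rng ∈ U ∧ g.lag = (m : ℤ) - n ∧ g.src ∈ W ∧ T^[m] g.rng = T^[n] g.src}

/-- The topology generated by the sets `Z(U, m, n, V)` with `U`, `V` open. -/
instance [TopologicalSpace X] : TopologicalSpace (DeaconuRenault T) :=
  TopologicalSpace.generateFrom
    {Z | ∃ (U : Set X) (m n : ℕ) (W : Set X), IsOpen U ∧ IsOpen W ∧ Z = basicSet U m n W}

variable (T) in
/-- The operations `(x,p,y)(y,q,z) = (x,p+q,z)` and `(x,p,y)⁻¹ = (y,-p,x)`. -/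
def groupoid : ArrowGroupoid X (DeaconuRenault T) where
  r := rng
  s := src
  unit x := ⟨x, 0, x, 0, 0, by simp, rfl⟩
  mul a b h := ⟨a.rng, a.lag + b.lag, b.src, by
    obtain ⟨m, n, hk, e⟩ := a.cond
    obtain ⟨m', n', hk', e'⟩ := b.cond
    refine ⟨m' + m, n + n', by push_cast; rw [hk, hk']; ring, ?_⟩
    rw [Function.iterate_add_apply, e, h, ← Function.iterate_add_apply, Nat.add_comm m' n,
      Function.iterate_add_apply, e', ← Function.iterate_add_apply]⟩
  inv a := ⟨a.src, -a.lag, a.rng, by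
    obtain ⟨m, n, hk, e⟩ := a.cond
    exact ⟨n, m, by rw [hk]; ring, e.symm⟩⟩
  r_unit _ := rfl
  s_unit _ := rfl
  r_mul _ _ _ := rfl
  s_mul _ _ _ := rfl
  r_inv _ := rfl
  s_inv _ := rfl
  mul_assoc a b c _ _ := DeaconuRenault.ext rfl (add_assoc _ _ _) rfl
  unit_mul a := DeaconuRenault.ext rfl (zero_add _) rfl
  mul_unit a := DeaconuRenault.ext rfl (add_zero _) rfl
  inv_mul a := DeaconuRenault.ext rfl (neg_add_cancel _) rfl
  mul_inv a := DeaconuRenault.ext rfl (add_neg_cancel _) rfl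

end DeaconuRenault

/-! ## Amplifications -/

/-- The arrows `(x, γ, y) ∈ X × Γ × X` with `r(γ) = π(x)` and `s(γ) = π(y)`, with the subspace
topology from the product. -/
abbrev Amplification {X : Type*} {Y : Type*} {Γ : Type*} (H : ArrowGroupoid Y Γ) (π : X → Y) :=
  {p : X × Γ × X // H.r p.2.1 = π p.1 ∧ H.s p.2.1 = π p.2.2}

/-- The operations `(x,γ,y)(y,η,z) = (x,γη,z)` and `(x,γ,y)⁻¹ = (y,γ⁻¹,x)`. -/
def ArrowGroupoid.amplify {X : Type*} {Y : Type*} {Γ : Type*} (H : ArrowGroupoid Y Γ) (π : X → Y) :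
    ArrowGroupoid X (Amplification H π) where
  r p := p.1.1
  s p := p.1.2.2
  unit x := ⟨(x, H.unit (π x), x), H.r_unit _, H.s_unit _⟩
  mul a b h := ⟨(a.1.1, H.mul a.1.2.1 b.1.2.1
      (a.2.2.trans ((congrArg π h).trans b.2.1.symm)), b.1.2.2),
    (H.r_mul _ _ _).trans a.2.1, (H.s_mul _ _ _).trans b.2.2⟩
  inv a := ⟨(a.1.2.2, H.inv a.1.2.1, a.1.1), (H.r_inv _).trans a.2.2, (H.s_inv _).trans a.2.1⟩
  r_unit _ := rfl
  s_unit _ := rfl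
  r_mul _ _ _ := rfl
  s_mul _ _ _ := rfl
  r_inv _ := rfl
  s_inv _ := rfl
  mul_assoc a b c _ _ := Subtype.ext (Prod.ext rfl (Prod.ext (H.mul_assoc _ _ _ _ _) rfl))
  unit_mul a := by
    obtain ⟨⟨x, γ, y⟩, h1, h2⟩ := a
    simp only at h1 h2
    have := H.unit_mul γ
    refine Subtype.ext (Prod.ext rfl (Prod.ext ?_ rfl))
    simp only [← h1, this]
  mul_unit a := by
    obtain ⟨⟨x, γ, y⟩, h1, h2⟩ := a
    simp only at h1 h2
    have := H.mul_unit γ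
    refine Subtype.ext (Prod.ext rfl (Prod.ext ?_ rfl))
    simp only [← h2, this]
  inv_mul a := Subtype.ext (Prod.ext rfl (Prod.ext
    ((H.inv_mul a.1.2.1).trans (congrArg H.unit a.2.2)) rfl))
  mul_inv a := Subtype.ext (Prod.ext rfl (Prod.ext
    ((H.mul_inv a.1.2.1).trans (congrArg H.unit a.2.1)) rfl))

/-! ## The stable equivalence relation and the stable Ruelle groupoid

Here `X` is a topological space with a homeomorphism `φ`, and `d` is a metric on `X` that induces the
topology. -/

/-- The metrics on a topological space `X` that induce its topology. -/
structure CompatibleMetric (X : Type u) [TopologicalSpace X] where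
  dist : X → X → ℝ
  dist_self : ∀ x, dist x x = 0
  dist_comm : ∀ x y, dist x y = dist y x
  dist_triangle : ∀ x y z, dist x z ≤ dist x y + dist y z
  eq_of_dist_eq_zero : ∀ x y, dist x y = 0 → x = y
  isOpen_iff : ∀ U : Set X, IsOpen U ↔ ∀ x ∈ U, ∃ δ > 0, ∀ y, dist x y < δ → y ∈ U

lemma CompatibleMetric.dist_nonneg {X : Type u} [TopologicalSpace X] (d : CompatibleMetric X)
    (x y : X) : 0 ≤ d.dist x y := by
  have h := d.dist_triangle x y x
  rw [d.dist_self, d.dist_comm y x] at h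
  linarith

section Stable

variable {X : Type u} [TopologicalSpace X] (d : CompatibleMetric X) (φ : X ≃ₜ X)

/-- The stable equivalence relation: `d(φ^m(ξ), φ^m(η)) → 0` as `m → ∞`. -/
def stableSet : Set (X × X) :=
  {p | Filter.Tendsto (fun m : ℕ => d.dist (φ^[m] p.1) (φ^[m] p.2)) Filter.atTop (𝓝 0)}

/-- The set of all `(ξ, η)` with `d(φ^m(ξ), φ^m(η)) < ε` for all `m ≥ M`. -/
def stableLevel (ε : ℝ) (M : ℕ) : Set (X × X) :=
  {p | ∀ m : ℕ, M ≤ m → d.dist (φ^[m] p.1) (φ^[m] p.2) < ε}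

/-- The stable equivalence relation as a type. The parameter `ε` only enters its topology. -/
structure StableRel (ε : ℝ) : Type u where
  pair : X × X
  mem : pair ∈ stableSet d φ

/-- The inductive limit topology for the sets of pairs with `d(φ^m(ξ), φ^m(η)) < ε` for all
`m ≥ M`, `M ∈ ℕ`, each with the subspace topology from `X × X`. -/
instance (ε : ℝ) : TopologicalSpace (StableRel d φ ε) :=
  ⨆ M : ℕ, TopologicalSpace.coinduced
    (fun p : {p : X × X // p ∈ stableSet d φ ∧ p ∈ stableLevel d φ ε M} =>
      (⟨p.1, p.2.1⟩ : StableRel d φ ε)) inferInstance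

/-- The arrows `(ξ, n, η)` with `(φ^n(ξ), η)` in the stable equivalence relation. The parameter `ε`
only enters the topology. -/
@[ext] structure StableRuelle (ε : ℝ) where
  rng : X
  lag : ℤ
  src : X
  mem : ((φ.toEquiv ^ lag : Equiv.Perm X) rng, src) ∈ stableSet d φ

/-- The topology of the skew product by `ℤ`, obtained by identifying `(ξ, n, η)` with
`((φ^n(ξ), η), n)` in the product of the stable equivalence relation and `ℤ`. -/
instance (ε : ℝ) : TopologicalSpace (StableRuelle d φ ε) :=
  TopologicalSpace.induced
    (fun g => ((⟨_, g.mem⟩ : StableRel d φ ε), g.lag)) inferInstance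

variable {d φ}

lemma stableSet_refl (x : X) : (x, x) ∈ stableSet d φ := by
  simp only [stableSet, Set.mem_ofPred_eq]
  have : (fun m : ℕ => d.dist (φ^[m] x) (φ^[m] x)) = fun _ => 0 := by
    funext m; exact d.dist_self _
  rw [this]
  exact tendsto_const_nhds

lemma stableSet_symm {x y : X} (h : (x, y) ∈ stableSet d φ) : (y, x) ∈ stableSet d φ := by
  simp only [stableSet, Set.mem_ofPred_eq] at h ⊢
  refine h.congr fun m => d.dist_comm _ _

lemma stableSet_trans {x y z : X} (h : (x, y) ∈ stableSet d φ) (h' : (y, z) ∈ stableSet d φ) :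
    (x, z) ∈ stableSet d φ := by
  simp only [stableSet, Set.mem_ofPred_eq] at h h' ⊢
  have h2 := h.add h'
  rw [add_zero] at h2
  exact squeeze_zero (fun m => d.dist_nonneg _ _)
    (fun m => d.dist_triangle _ _ _) h2

lemma stableSet_map_iff {x y : X} : (φ x, φ y) ∈ stableSet d φ ↔ (x, y) ∈ stableSet d φ := by
  simp only [stableSet, Set.mem_ofPred_eq, ← Function.iterate_succ_apply]
  exact Filter.tendsto_add_atTop_iff_nat (f := fun m => d.dist (φ^[m] x) (φ^[m] y)) 1

lemma stableSet_zpow (n : ℤ) {x y : X} (h : (x, y) ∈ stableSet d φ) :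
    ((φ.toEquiv ^ n : Equiv.Perm X) x, (φ.toEquiv ^ n : Equiv.Perm X) y) ∈ stableSet d φ := by
  induction n with
  | zero => simpa using h
  | succ n ih =>
    rw [add_comm, zpow_add, zpow_one]
    exact stableSet_map_iff.2 ih
  | pred n ih =>
    rw [sub_eq_add_neg, add_comm, zpow_add, zpow_neg_one]
    refine stableSet_map_iff.1 ?_
    have e : ∀ z, φ ((φ.toEquiv⁻¹ * φ.toEquiv ^ (-(n : ℤ)) : Equiv.Perm X) z) =
        (φ.toEquiv ^ (-(n : ℤ)) : Equiv.Perm X) z := fun z => φ.toEquiv.apply_symm_apply _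
    rw [e, e]
    exact ih

variable (d φ) in
/-- The stable Ruelle groupoid, with `(ξ,n,η)(η,m,ζ) = (ξ,n+m,ζ)` and
`(ξ,n,η)⁻¹ = (η,-n,ξ)`. -/
def StableRuelle.groupoid (ε : ℝ) : ArrowGroupoid X (StableRuelle d φ ε) where
  r := rng
  s := src
  unit x := ⟨x, 0, x, stableSet_refl x⟩
  mul a b h := ⟨a.rng, a.lag + b.lag, b.src, by
    have h1 := stableSet_zpow b.lag a.mem
    rw [h] at h1
    rw [add_comm, zpow_add]
    exact stableSet_trans h1 b.mem⟩
  inv a := ⟨a.src, -a.lag, a.rng, by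
    have h1 := stableSet_zpow (-a.lag) a.mem
    rw [← Equiv.Perm.mul_apply, ← zpow_add, neg_add_cancel, zpow_zero] at h1
    exact stableSet_symm h1⟩
  r_unit _ := rfl
  s_unit _ := rfl
  r_mul _ _ _ := rfl
  s_mul _ _ _ := rfl
  r_inv _ := rfl
  s_inv _ := rfl
  mul_assoc a b c _ _ := StableRuelle.ext rfl (add_assoc _ _ _) rfl
  unit_mul a := StableRuelle.ext rfl (zero_add _) rfl
  mul_unit a := StableRuelle.ext rfl (add_zero _) rfl
  inv_mul a := StableRuelle.ext rfl (neg_add_cancel _) rfl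
  mul_inv a := StableRuelle.ext rfl (add_neg_cancel _) rfl

end Stable

/-- The dual groupoid of a self-similar groupoid action: the Deaconu–Renault groupoid of the limit
space and its shift. -/
abbrev SelfSimilarAction.dualGroupoid {V : Type u} {A : Type v} {E : DirGraph V A}
    [CategoryTheory.Groupoid.{w} V] [Finite V] (S : SelfSimilarAction E) :
    ArrowGroupoid S.LimitSpace (DeaconuRenault S.shiftJ) :=
  DeaconuRenault.groupoid S.shiftJ

/-! The action is treated as an automaton: `S.Step g e f h` says that state `g` reads `e`, writes
`f` and moves to `h`. It is deterministic by faithfulness. Contraction yields a finite set `N` of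
states, closed under transitions, into which every run falls after a number of letters depending
only on its initial state (`Contracting.exists_isNucleus`). By a compactness argument, asymptotic
equivalence of left-infinite or bi-infinite paths then means that the paths label an infinite run
inside `N` (`asympLeft_iff`, `asympBi_iff`). Such relations are projections of closed sets along a
compact space of runs, hence closed, and the two quotients are compact, Hausdorff and second
countable. Extending runs to the right by one letter, or by infinitely many, shows that the shift
and the projection are open.

Regularity enters through one fact: two runs in `N` with the same input and output end in the same
state once they are long enough (`exists_synchronizing`). If all iterates of two points of the limit
space stay close, short runs exist on every window of their representatives. Synchronization glues
overlapping windows into one infinite run, so the points coincide (`exists_expansive`). In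
particular the shift is locally injective.

The rest is topological dynamics of a semiconjugacy `π ∘ φ = T ∘ π`, with two inputs. Expansivity:
orbits that stay `ε`-close have equal image under `π`. Contraction: `φ^m` shrinks the fibres of `π`
uniformly. The latter holds because the maps `π ∘ φ⁻ᵐ` jointly separate points
(`eq_of_proj_symm_iterate`, `exists_forall_iterate_mem`). Together they give, for some `K`,
`stableLevel ε M ⊆ {T^M(π ξ) = T^M(π η)} ⊆ stableLevel ε (K + M)`, and the middle set lies in the
stable relation. So stable equivalence means that the projections are eventually equal under `T`,
which gives the bijection. The inclusions also match the inductive limit topology with that of the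
Deaconu–Renault groupoid, where local injectivity of `T` lets continuity be tested on range and
source inside a single set `T^m(x) = T^n(y)`. The Ruelle groupoid inherits its topological groupoid
structure through this homeomorphism. -/

/-! ## Topological preliminaries -/

/-- A family of conditions on functions with values in a finite set, each depending on finitely many
coordinates, is satisfiable if all finite subfamilies are. -/
lemma exists_forall_of_finset {ι J T : Type*} [Finite T] (P : J → (ι → T) → Prop)
    (hP : ∀ j, ∃ s : Finset ι, ∀ t t' : ι → T, (∀ i ∈ s, t i = t' i) → P j t → P j t')
    (h : ∀ s : Finset J, ∃ t, ∀ j ∈ s, P j t) : ∃ t, ∀ j, P j t := by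
  let _ : TopologicalSpace T := ⊥
  have : DiscreteTopology T := ⟨rfl⟩
  have hc : ∀ j, IsClosed {t : ι → T | P j t} := by
    intro j
    obtain ⟨s, hs⟩ := hP j
    rw [← isOpen_compl_iff, isOpen_iff_mem_nhds]
    intro t ht
    have : ∀ᶠ t' in 𝓝 t, ∀ i ∈ s, t' i = t i := by
      rw [Filter.eventually_all_finset]
      intro i _
      exact (continuous_apply i).continuousAt.eventually
        (show ∀ᶠ y in 𝓝 (t i), y = t i by rw [nhds_discrete]; simp)
    filter_upwards [this] with t' ht' hp
    exact ht (hs _ _ ht' hp)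
  by_contra hne
  have he : (Set.univ ∩ ⋂ j, {t : ι → T | P j t}) = ∅ := by
    rw [Set.eq_empty_iff_forall_notMem]
    rintro t ⟨-, ht⟩
    exact hne ⟨t, fun j => Set.mem_iInter.1 ht j⟩
  obtain ⟨s, hs⟩ := isCompact_univ.elim_finite_subfamily_closed _ hc he
  obtain ⟨t, ht⟩ := h s
  have : t ∈ (Set.univ ∩ ⋂ j ∈ s, {t : ι → T | P j t}) :=
    ⟨trivial, Set.mem_iInter₂.2 ht⟩
  rw [hs] at this
  exact this

/-- The quotient map by a closed equivalence relation on a compact space is closed. -/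
lemma isClosedMap_quotient_mk {X : Type*} [TopologicalSpace X] [CompactSpace X]
    {s : Setoid X} (hs : IsClosed {p : X × X | s p.1 p.2}) : IsClosedMap (Quotient.mk s) := by
  intro C hC
  rw [← isQuotientMap_quotient_mk'.isClosed_preimage]
  have h1 : IsClosed ({p : X × X | s p.1 p.2} ∩ Prod.fst ⁻¹' C) :=
    hs.inter (hC.preimage continuous_fst)
  have h2 := isClosedMap_snd_of_compactSpace _ h1
  convert h2 using 1
  ext y
  constructor
  · rintro ⟨x, hx, hxy⟩
    exact ⟨(x, y), ⟨Quotient.exact hxy, hx⟩, rfl⟩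
  · rintro ⟨⟨x, y'⟩, ⟨hxy, hx⟩, rfl⟩
    exact ⟨x, hx, Quotient.sound hxy⟩

/-- Distinct fibres are disjoint compact sets, so they have disjoint neighbourhoods. Closedness of
`q` shrinks these to preimages of neighbourhoods downstairs. -/
lemma IsClosedMap.t2Space {X Y : Type*} [TopologicalSpace X] [TopologicalSpace Y] [T2Space X]
    [CompactSpace X] {q : X → Y} (hq : IsClosedMap q) (hc : Continuous q)
    (hsurj : Function.Surjective q) : T2Space Y := by
  have hfib : ∀ y, IsClosed (q ⁻¹' {y}) := by
    intro y
    obtain ⟨x, rfl⟩ := hsurj y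
    have := hq _ (isClosed_singleton (x := x))
    rw [Set.image_singleton] at this
    exact this.preimage hc
  rw [t2Space_iff_disjoint_nhds]
  intro y y' hne
  have hd : Disjoint (q ⁻¹' {y}) (q ⁻¹' {y'}) :=
    Disjoint.preimage q (Set.disjoint_singleton.2 hne)
  obtain ⟨U, W, hU, hW, hyU, hyW, hUW⟩ := SeparatedNhds.of_isCompact_isCompact
    (hfib y).isCompact (hfib y').isCompact hd
  have h1 : U ∈ Filter.comap q (𝓝 y) := by
    rw [hq.comap_nhds_eq hc]; exact hU.mem_nhdsSet.2 hyU
  have h2 : W ∈ Filter.comap q (𝓝 y') := by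
    rw [hq.comap_nhds_eq hc]; exact hW.mem_nhdsSet.2 hyW
  obtain ⟨U', hU', h1⟩ := h1
  obtain ⟨W', hW', h2⟩ := h2
  refine Filter.disjoint_of_disjoint_of_mem ?_ hU' hW'
  rw [Set.disjoint_left]
  intro z hz hz'
  obtain ⟨x, rfl⟩ := hsurj z
  exact Set.disjoint_left.1 hUW (h1 hz) (h2 hz')

/-- For each finite union of basic open sets, take the points whose whole fibre lies in it. These
sets are open because `q` is closed, and compactness of fibres makes them a basis. -/
lemma IsClosedMap.secondCountableTopology {X Y : Type*} [TopologicalSpace X] [TopologicalSpace Y]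
    [T2Space X] [CompactSpace X] [SecondCountableTopology X] {q : X → Y} (hq : IsClosedMap q)
    (hc : Continuous q) (hsurj : Function.Surjective q) : SecondCountableTopology Y := by
  have := hq.t2Space hc hsurj
  let b := TopologicalSpace.countableBasis X
  let B : Set (Set Y) := (fun F : Set (Set X) => (q '' (⋃₀ F)ᶜ)ᶜ) '' {F | F ⊆ b ∧ F.Finite}
  have hB : B.Countable :=
    (Set.countable_ofPred_finite_subset (TopologicalSpace.countable_countableBasis X)).image _ |>.mono
      (by rintro _ ⟨F, ⟨h1, h2⟩, rfl⟩; exact ⟨F, ⟨h2, h1⟩, rfl⟩)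
  have hbo : ∀ F : Set (Set X), F ⊆ b → IsOpen (⋃₀ F) := fun F hF =>
    isOpen_sUnion fun s hs => TopologicalSpace.isOpen_of_mem_countableBasis (hF hs)
  refine (TopologicalSpace.isTopologicalBasis_of_isOpen_of_nhds
    (s := B) ?_ ?_).secondCountableTopology hB
  · rintro _ ⟨F, ⟨hF, -⟩, rfl⟩
    exact (hq _ (hbo F hF).isClosed_compl).isOpen_compl
  · intro y O hy hO
    have hK : IsCompact (q ⁻¹' {y}) := (isClosed_singleton.preimage hc).isCompact
    have hcov : ∀ x ∈ q ⁻¹' {y}, ∃ s ∈ b, x ∈ s ∧ s ⊆ q ⁻¹' O := by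
      intro x hx
      have hx' : x ∈ q ⁻¹' O := by
        have : q x = y := hx
        simpa [this] using hy
      exact (TopologicalSpace.isBasis_countableBasis X).exists_subset_of_mem_open hx'
        (hO.preimage hc)
    choose! f hfb hxf hfO using hcov
    obtain ⟨t, ht⟩ := hK.elim_nhds_subcover' (fun x hx => f x) (fun x hx =>
      (TopologicalSpace.isOpen_of_mem_countableBasis (hfb x hx)).mem_nhds (hxf x hx))
    refine ⟨_, ⟨(fun x : q ⁻¹' {y} => f x) '' (t : Set (q ⁻¹' {y})), ⟨?_, t.finite_toSet.image _⟩, rfl⟩,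
      ?_, ?_⟩
    · rintro _ ⟨x, -, rfl⟩
      exact hfb x x.2
    · rintro ⟨x, hx, hx0⟩
      refine hx ?_
      obtain ⟨z, hz, hxz⟩ := Set.mem_iUnion₂.1 (ht (show x ∈ q ⁻¹' {y} from hx0))
      exact ⟨_, ⟨z, hz, rfl⟩, hxz⟩
    · intro z hz
      obtain ⟨x, rfl⟩ := hsurj z
      by_contra hzO
      refine hz ⟨x, ?_, rfl⟩
      rintro ⟨_, ⟨x', -, rfl⟩, hx⟩
      exact hzO (hfO x' x'.2 hx)

/-- A decreasing sequence of closed sets in a compact space is eventually contained in any given open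
set that contains the intersection. -/
lemma exists_subset_of_antitone_of_isClosed {X : Type*} [TopologicalSpace X] [CompactSpace X]
    {C : ℕ → Set X} (hC : ∀ n, IsClosed (C n)) (hanti : Antitone C) {W : Set X} (hW : IsOpen W)
    (h : ⋂ n, C n ⊆ W) : ∃ n, C n ⊆ W := by
  refine exists_subset_nhds_of_compactSpace (directed_of_isDirected_le fun i j hij => hanti hij) hC ?_
  intro x hx
  exact hW.mem_nhds (h hx)

/-! ## The automaton of a self-similar action -/

namespace SelfSimilarAction

open DirGraph CategoryTheory

variable {V : Type u} {A : Type v} {E : DirGraph V A} [CategoryTheory.Groupoid.{w} V]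
variable {S : SelfSimilarAction E}

lemma Acts.eq {g : GArrow V} {μ ν ν' : List A} (h : S.Acts g μ ν) (h' : S.Acts g μ ν') :
    ν = ν' := by
  obtain ⟨_, rfl⟩ := h
  obtain ⟨_, rfl⟩ := h'
  rfl

lemma Acts.isPath_right {g : GArrow V} {μ ν : List A} (h : S.Acts g μ ν) : E.IsPath g.2.1 ν := by
  obtain ⟨p, rfl⟩ := h
  exact ((S.act g.2.2).toEquiv ⟨μ, p⟩).2

lemma acts_nil (g : GArrow V) : S.Acts g [] [] :=
  ⟨trivial, List.length_eq_zero_iff.1 ((S.act _).length_eq _)⟩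

lemma exists_acts (g : GArrow V) {μ : List A} (h : E.IsPath g.1 μ) : ∃ ν, S.Acts g μ ν :=
  ⟨_, h, rfl⟩

variable (S) in
/-- The transitions of the automaton of the action: `g · e = f` and `g|_e = h`. -/
def Step (g : GArrow V) (e f : A) (h : GArrow V) : Prop :=
  E.r e = g.1 ∧ h.1 = E.s e ∧ h.2.1 = E.s f ∧
    ∀ μ ν, S.Acts h μ ν → S.Acts g (e :: μ) (f :: ν)

lemma step_restrEdge {x y : V} (g : x ⟶ y) (e : A) (he : E.r e = x) :
    S.Step ⟨x, y, g⟩ e (S.actEdge g e he) ⟨_, _, S.restrEdge g e he⟩ := by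
  refine ⟨he, rfl, rfl, ?_⟩
  rintro μ ν ⟨p, hp⟩
  refine ⟨⟨he, p⟩, ?_⟩
  have h := (S.selfSimilar g e he).choose_spec.choose_spec ⟨μ, p⟩
  exact h.trans (congrArg _ hp)

lemma exists_step (g : GArrow V) (e : A) (he : E.r e = g.1) : ∃ f h, S.Step g e f h :=
  ⟨_, _, step_restrEdge g.2.2 e he⟩

namespace Step

variable {g g' h h' : GArrow V} {e f f' : A}

lemma acts (hs : S.Step g e f h) : S.Acts g [e] [f] := hs.2.2.2 _ _ (acts_nil h)

lemma r_left (hs : S.Step g e f h) : E.r e = g.1 := hs.1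

lemma r_right (hs : S.Step g e f h) : E.r f = g.2.1 := hs.acts.isPath_right.1

lemma eq_right (hs : S.Step g e f h) (hs' : S.Step g e f' h') : f = f' := by
  have := hs.acts.eq hs'.acts
  simpa using this

/-- This is where faithfulness is used: both candidates have the same endpoints and act identically
on all finite paths. -/
lemma eq_state (hs : S.Step g e f h) (hs' : S.Step g e f' h') : h = h' := by
  obtain rfl := hs.eq_right hs'
  obtain ⟨-, h1, h2, h3⟩ := hs
  obtain ⟨-, h1', h2', h3'⟩ := hs'
  obtain ⟨x, y, h⟩ := h
  obtain ⟨x', y', h'⟩ := h'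
  dsimp only at h1 h2 h1' h2'
  subst h1 h2 h1' h2'
  congr 2
  refine S.faithful _ _ (PIso.ext (Equiv.ext fun μ => Subtype.ext ?_))
  have := (h3 μ.1 _ ⟨μ.2, rfl⟩).eq (h3' μ.1 _ ⟨μ.2, rfl⟩)
  simpa using this

lemma inv (hs : S.Step g e f h) : S.Step (invArrow g) f e (invArrow h) := by
  refine ⟨hs.r_right, hs.2.2.1, hs.2.1, fun ν μ hv => ?_⟩
  refine (hs.2.2.2 μ ν ?_).inv
  have := hv.inv
  simpa [invArrow] using this

end Step

lemma compArrow_mk {x y z : V} (g : x ⟶ y) (h : y ⟶ z) :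
    compArrow (⟨x, y, g⟩ : GArrow V) ⟨y, z, h⟩ = ⟨x, z, g ≫ h⟩ := by
  simp [compArrow]

/-- The shared middle letter forces the arrows to be composable, so the fallback value of
`compArrow` never occurs. -/
lemma Step.comp {g g' h h' : GArrow V} {e f f' : A} (hs : S.Step g e f h)
    (hs' : S.Step g' f f' h') : S.Step (compArrow g g') e f' (compArrow h h') := by
  have hg : g.2.1 = g'.1 := hs.r_right.symm.trans hs'.r_left
  have hh : h.2.1 = h'.1 := hs.2.2.1.trans hs'.2.1.symm
  have key : ∀ μ ρ, S.Acts (compArrow h h') μ ρ → ∃ ν, S.Acts h μ ν ∧ S.Acts h' ν ρ := by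
    obtain ⟨x, y, h⟩ := h
    obtain ⟨y', z, h'⟩ := h'
    dsimp only at hh
    subst hh
    rw [compArrow_mk]
    rintro μ ρ ⟨p, hp⟩
    refine ⟨_, ⟨p, rfl⟩, ((S.act h).toEquiv ⟨μ, p⟩).2, ?_⟩
    rw [← hp]
    simp only [S.act_comp, Equiv.trans_apply]
  have hcg : (compArrow g g').1 = g.1 := by simp [compArrow, hg]
  have hc1 : (compArrow h h').1 = h.1 := by simp [compArrow, hh]
  have hc2 : (compArrow h h').2.1 = h'.2.1 := by rw [compArrow, dif_pos hh]
  refine ⟨hs.1.trans hcg.symm, hc1.trans hs.2.1, hc2.trans hs'.2.2.1, fun μ ρ hμ => ?_⟩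
  obtain ⟨ν, h1, h2⟩ := key μ ρ hμ
  exact (hs.2.2.2 _ _ h1).comp (hs'.2.2.2 _ _ h2)

lemma eq_of_compArrow_inv_eq_unit {g g' : GArrow V} {x : V} (h1 : g.1 = g'.1) (h2 : g.2.1 = g'.2.1)
    (h : compArrow g (invArrow g') = GArrow.unit x) : g = g' := by
  obtain ⟨a, b, g⟩ := g
  obtain ⟨a', b', g'⟩ := g'
  dsimp only at h1 h2
  subst h1 h2
  rw [invArrow, compArrow_mk] at h
  simp only [GArrow.unit, Sigma.mk.injEq] at h
  obtain ⟨rfl, h⟩ := h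
  simp only [heq_eq_eq, Sigma.mk.injEq, true_and] at h
  congr 2
  rw [Groupoid.inv_eq_inv, IsIso.comp_inv_eq, Category.id_comp] at h
  exact h

lemma Acts.exists_step {g : GArrow V} {e f : A} {μ ν : List A} (h : S.Acts g (e :: μ) (f :: ν)) :
    ∃ k, S.Step g e f k ∧ S.Acts k μ ν := by
  have hp := h.choose
  obtain ⟨f', k, hk⟩ := SelfSimilarAction.exists_step (S := S) g e hp.1
  obtain ⟨ν', hν⟩ := exists_acts (S := S) k (hk.2.1 ▸ hp.2 : E.IsPath k.1 μ)
  have h1 := h.eq (hk.2.2.2 _ _ hν)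
  simp only [List.cons.injEq] at h1
  obtain ⟨rfl, rfl⟩ := h1
  exact ⟨k, hk, hν⟩

lemma acts_initial {k : ℕ → GArrow V} {x y : ℕ → A} {n : ℕ}
    (h : ∀ i < n, S.Step (k i) (x i) (y i) (k (i + 1))) :
    S.Acts (k 0) (initial x n) (initial y n) := by
  induction n generalizing k x y with
  | zero => exact acts_nil _
  | succ n ih =>
    refine (h 0 n.succ_pos).2.2.2 _ _ ?_
    exact ih (k := fun i => k (i + 1)) (x := fun i => x (i + 1)) (y := fun i => y (i + 1))
      fun i hi => h (i + 1) (Nat.succ_lt_succ hi)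

lemma acts_lastWord {k : ℕ → GArrow V} {x y : E.LeftPath} {n : ℕ}
    (h : ∀ i < n, S.Step (k (i + 1)) (x.1 i) (y.1 i) (k i)) :
    S.Acts (k n) (x.lastWord n) (y.lastWord n) := by
  induction n with
  | zero => exact acts_nil _
  | succ n ih => exact (h n n.lt_succ_self).2.2.2 _ _ (ih fun i hi => h i (hi.trans n.lt_succ_self))

/-- The index of a state counts the letters still to be read, in line with the storage of
left-infinite paths: the run starts at `k n` and ends at `k 0`. -/
lemma Acts.exists_states {x y : E.LeftPath} {n : ℕ} {g : GArrow V}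
    (h : S.Acts g (x.lastWord n) (y.lastWord n)) :
    ∃ k : ℕ → GArrow V, k n = g ∧ ∀ i < n, S.Step (k (i + 1)) (x.1 i) (y.1 i) (k i) := by
  induction n generalizing g with
  | zero => exact ⟨fun _ => g, rfl, fun i hi => absurd hi i.not_lt_zero⟩
  | succ n ih =>
    obtain ⟨h', hs, ha⟩ := Acts.exists_step h
    obtain ⟨k, rfl, hk⟩ := ih ha
    refine ⟨Function.update k (n + 1) g, by simp, fun i hi => ?_⟩
    rw [Function.update_of_ne hi.ne]
    rcases Nat.lt_succ_iff_lt_or_eq.1 hi with hi | rfl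
    · rw [Function.update_of_ne (by omega)]
      exact hk i hi
    · rw [Function.update_self]
      exact hs

/-- Translates between `restr` and runs of the automaton, so that the conclusion of regularity can
be read off a run. -/
lemma restr_initial {n : ℕ} {g : GArrow V} {k : ℕ → GArrow V} {x y : ℕ → A} (hk : k 0 = g)
    (h : ∀ i < n, S.Step (k i) (x i) (y i) (k (i + 1))) (hp : E.IsPath g.1 (initial x n)) :
    S.restr (initial x n) g hp = k n := by
  induction n generalizing g k x y with
  | zero => exact hk.symm
  | succ n ih =>
    subst hk
    refine ih (k := fun i => k (i + 1)) (x := fun i => x (i + 1)) (y := fun i => y (i + 1)) ?_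
      (fun i hi => h (i + 1) (Nat.succ_lt_succ hi)) _
    exact (h 0 n.succ_pos).eq_state (step_restrEdge _ _ _)

/-! ### The nucleus -/

variable (S) in
/-- `S.Reach n g h`: the arrow `h` is a restriction of `g` by a path of length `n`. -/
def Reach : ℕ → GArrow V → GArrow V → Prop
  | 0, g, h => g = h
  | n + 1, g, h => ∃ k, (∃ e f, S.Step g e f k) ∧ Reach n k h

lemma reach_succ_iff {n : ℕ} {g h : GArrow V} :
    S.Reach (n + 1) g h ↔ ∃ k, S.Reach n g k ∧ ∃ e f, S.Step k e f h := by
  induction n generalizing g with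
  | zero => simp [Reach]
  | succ n ih =>
    constructor
    · rintro ⟨k, hk, hr⟩
      obtain ⟨l, hl, hs⟩ := ih.1 hr
      exact ⟨l, ⟨k, hk, hl⟩, hs⟩
    · rintro ⟨l, ⟨k, hk, hl⟩, hs⟩
      exact ⟨k, hk, ih.2 ⟨l, hl, hs⟩⟩

lemma reach_of_steps {n : ℕ} {k : ℕ → GArrow V} {x y : ℕ → A}
    (h : ∀ i < n, S.Step (k i) (x i) (y i) (k (i + 1))) : S.Reach n (k 0) (k n) := by
  induction n with
  | zero => rfl
  | succ n ih =>
    exact reach_succ_iff.2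
      ⟨k n, ih fun i hi => h i (hi.trans n.lt_succ_self), _, _, h n n.lt_succ_self⟩

lemma Reach.exists_restr {n : ℕ} {g h : GArrow V} (hr : S.Reach n g h) :
    ∃ (μ : List A) (hp : E.IsPath g.1 μ), μ.length = n ∧ S.restr μ g hp = h := by
  induction n generalizing g with
  | zero => exact ⟨[], trivial, rfl, hr⟩
  | succ n ih =>
    obtain ⟨k, ⟨e, f, hs⟩, hr⟩ := hr
    rw [hs.eq_state (step_restrEdge g.2.2 e hs.1)] at hr
    obtain ⟨μ, hp, hl, hμ⟩ := ih hr
    exact ⟨e :: μ, ⟨hs.1, hp⟩, by simp [hl], hμ⟩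

lemma finite_step [Finite A] (g : GArrow V) : {h | ∃ e f, S.Step g e f h}.Finite := by
  have : {h | ∃ e f, S.Step g e f h} = ⋃ e, {h | ∃ f, S.Step g e f h} := by
    ext; simp
  rw [this]
  refine Set.finite_iUnion fun e => Set.Subsingleton.finite ?_
  rintro h ⟨f, hs⟩ h' ⟨f', hs'⟩
  exact hs.eq_state hs'

lemma finite_reach [Finite A] (n : ℕ) (g : GArrow V) : {h | S.Reach n g h}.Finite := by
  induction n with
  | zero => exact (Set.finite_singleton g).subset fun h hr => hr.symm
  | succ n ih =>
    refine (ih.biUnion fun k _ => finite_step (S := S) k).subset fun h hr => ?_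
    obtain ⟨k, hk, hs⟩ := reach_succ_iff.1 hr
    exact Set.mem_biUnion hk hs

variable (S) in
/-- A finite set of arrows that is closed under restriction and contains all sufficiently deep
restrictions of every arrow. -/
structure IsNucleus (N : Set (GArrow V)) : Prop where
  finite : N.Finite
  closed : ∀ {g e f h}, g ∈ N → S.Step g e f h → h ∈ N
  absorbing : ∀ g, ∃ n, ∀ h, S.Reach n g h → h ∈ N

lemma Contracting.exists_isNucleus [Finite A] (hc : S.Contracting) : ∃ N, S.IsNucleus N := by
  obtain ⟨F, hF, hm⟩ := hc
  choose m hm using hm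
  have hmF : ∀ g h, S.Reach (m g) g h → h ∈ F := by
    intro g h hr
    obtain ⟨μ, hp, hl, rfl⟩ := hr.exists_restr
    exact hm g μ hp hl
  -- Start from the one-step restrictions of elements of `F` and follow each `g` down to depth `m
  -- g`. At that depth the run is back in `F`, so its next state is again a starting point. Starting
  -- one step after `F` makes this work even where `m` vanishes.
  let N : Set (GArrow V) :=
    ⋃ g ∈ ⋃ f ∈ F, {h | ∃ e e', S.Step f e e' h}, ⋃ i ∈ Set.Iic (m g), {h | S.Reach i g h}
  have hmem : ∀ h, h ∈ N ↔ ∃ f ∈ F, ∃ g, (∃ e e', S.Step f e e' g) ∧ ∃ i ≤ m g, S.Reach i g h := by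
    intro h
    simp only [N, Set.mem_iUnion, Set.mem_ofPred_eq, Set.mem_Iic, exists_prop]
    constructor
    · rintro ⟨g, ⟨f, hf, hg⟩, h⟩
      exact ⟨f, hf, g, hg, h⟩
    · rintro ⟨f, hf, g, hg, h⟩
      exact ⟨g, ⟨f, hf, hg⟩, h⟩
  refine ⟨N, ?_, ?_, ?_⟩
  · exact (hF.biUnion fun f _ => finite_step f).biUnion fun g _ =>
      (Set.finite_Iic _).biUnion fun i _ => finite_reach i g
  · intro g e f h hg hs
    rw [hmem] at hg ⊢
    obtain ⟨f₀, hf₀, g₀, hg₀, i, hi, hr⟩ := hg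
    rcases hi.lt_or_eq with hi | rfl
    · exact ⟨f₀, hf₀, g₀, hg₀, i + 1, hi, reach_succ_iff.2 ⟨g, hr, _, _, hs⟩⟩
    · exact ⟨g, hmF _ _ hr, h, ⟨_, _, hs⟩, 0, Nat.zero_le _, rfl⟩
  · refine fun g => ⟨m g + 1, fun h hr => ?_⟩
    obtain ⟨k, hk, hs⟩ := reach_succ_iff.1 hr
    exact (hmem h).2 ⟨k, hmF _ _ hk, h, hs, 0, Nat.zero_le _, rfl⟩

lemma IsNucleus.mem_of_steps {N : Set (GArrow V)} (hN : S.IsNucleus N) {k : ℕ → GArrow V}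
    {x y : ℕ → A} {n m : ℕ} (h : ∀ i < n, S.Step (k i) (x i) (y i) (k (i + 1)))
    (hm : ∀ h, S.Reach m (k 0) h → h ∈ N) {i : ℕ} (hmi : m ≤ i) (hin : i ≤ n) : k i ∈ N := by
  induction i, hmi using Nat.le_induction with
  | base => exact hm _ (reach_of_steps fun i hi => h i (hi.trans_le hin))
  | succ i hi ih => exact hN.closed (ih (by omega)) (h i (by omega))

section Nucleus

variable {N : Set (GArrow V)} (hN : S.IsNucleus N)
include hN

/-- The given arrows take finitely many values, so one bound `K` covers the time they need to enter
`N`. Runs started far to the left are therefore inside `N` on any prescribed window near the right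
end, and compactness assembles an infinite run. -/
lemma IsNucleus.asympLeft_iff {x y : E.LeftPath} :
    S.AsympLeft x y ↔ ∃ k : ℕ → N, ∀ n, S.Step (k (n + 1)) (x.1 n) (y.1 n) (k n) := by
  have := hN.finite.to_subtype
  constructor
  · rintro ⟨g, hg, h⟩
    choose m hm using hN.absorbing
    let K := hg.toFinset.sup m
    have hK : ∀ n, m (g n) ≤ K := fun n => Finset.le_sup (f := m) (by simp)
    refine exists_forall_of_finset (fun n (k : ℕ → N) =>
      S.Step (k (n + 1)) (x.1 n) (y.1 n) (k n)) ?_ ?_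
    · refine fun n => ⟨{n, n + 1}, fun t t' ht hs => ?_⟩
      rwa [← ht n (by simp), ← ht (n + 1) (by simp)]
    · intro s
      obtain ⟨M, hM⟩ := s.exists_nat_subset_range
      obtain ⟨k, hk, hs⟩ := (h (M + K)).exists_states
      have hmem : ∀ i ≤ M, k i ∈ N := by
        intro i hi
        -- The run is reindexed by the number of letters already read, which reverses the order of
        -- its states.
        have h1 := hN.mem_of_steps (S := S) (k := fun j => k (M + K + 1 - j)) (n := M + K + 1)
          (x := fun j => x.1 (M + K + 1 - (j + 1))) (y := fun j => y.1 (M + K + 1 - (j + 1)))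
          (m := m (g (M + K))) (i := M + K + 1 - i) (fun j hj => by
            have h2 := hs (M + K + 1 - (j + 1)) (by omega)
            rwa [show M + K + 1 - (j + 1) + 1 = M + K + 1 - j by omega] at h2)
          (fun h hr => hm _ h (by simpa [hk] using hr)) (by have := hK (M + K); omega) (by omega)
        simpa [show M + K + 1 - (M + K + 1 - i) = i by omega] using h1
      -- States with index above `M` need not lie in `N`, so the sequence is frozen there; only
      -- transitions with `i < M` are tested.
      refine ⟨fun i => ⟨k (min i M), hmem _ (min_le_right _ _)⟩, fun i hi => ?_⟩
      have hi' : i < M := Finset.mem_range.1 (hM hi)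
      simp only [min_eq_left hi'.le, min_eq_left (Nat.succ_le_of_lt hi')]
      exact hs i (by omega)
  · rintro ⟨k, hk⟩
    refine ⟨fun n => k (n + 1), hN.finite.subset ?_, fun n => ?_⟩
    · rintro _ ⟨n, rfl⟩
      exact (k (n + 1)).2
    · exact acts_lastWord (k := fun i => (k i : GArrow V)) (x := x) (y := y) (n := n + 1)
        fun i _ => hk i

/-- Truncating on the right at position `m` gives a run in `N` on all letters before `m`. Every
finite set of positions lies to the left of some cut, and compactness does the rest. -/
lemma IsNucleus.exists_states_of_left {x y : E.BiPath}
    (h : ∀ m : ℕ, S.AsympLeft (x.translate m).left (y.translate m).left) :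
    ∃ k : ℤ → N, ∀ n, S.Step (k n) (x.1 n) (y.1 n) (k (n + 1)) := by
  have := hN.finite.to_subtype
  refine exists_forall_of_finset (fun n (k : ℤ → N) =>
      S.Step (k n) (x.1 n) (y.1 n) (k (n + 1))) ?_ ?_
  · refine fun n => ⟨{n, n + 1}, fun t t' ht hs => ?_⟩
    rwa [← ht n (by simp), ← ht (n + 1) (by simp)]
  · intro s
    let m := s.sup Int.natAbs + 1
    obtain ⟨k, hk⟩ := hN.asympLeft_iff.1 (h m)
    refine ⟨fun j => k (m - j).toNat, fun j hj => ?_⟩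
    have hjm : j < m := by
      have := Finset.le_sup (f := Int.natAbs) hj
      omega
    have h1 := hk (m - j - 1).toNat
    have e1 : ((m : ℤ) - j - 1).toNat + 1 = (m - j).toNat := by omega
    have e2 : ((m : ℤ) - (j + 1)).toNat = (m - j - 1).toNat := by omega
    have e3 : -(((m : ℤ) - j).toNat : ℤ) + m = j := by omega
    simp only [BiPath.left, BiPath.translate, e1, e3] at h1
    change S.Step (k _) _ _ (k ((m : ℤ) - (j + 1)).toNat)
    rw [e2]
    exact h1

lemma IsNucleus.asympBi_of_states {x y : E.BiPath} {k : ℤ → N}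
    (hk : ∀ n, S.Step (k n) (x.1 n) (y.1 n) (k (n + 1))) : S.AsympBi x y := by
  refine ⟨fun n => k n, hN.finite.subset ?_, fun n m => ?_⟩
  · rintro _ ⟨n, rfl⟩
    exact (k n).2
  · have := acts_initial (S := S) (k := fun i : ℕ => (k (n + i) : GArrow V))
      (x := (x.tail n).1) (y := (y.tail n).1) (n := m) fun i _ => by
        have := hk (n + i)
        rwa [show n + (i : ℤ) + 1 = n + ((i + 1 : ℕ) : ℤ) by push_cast; ring] at this
    simpa using this

lemma IsNucleus.asympBi_of_left {x y : E.BiPath}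
    (h : ∀ m : ℕ, S.AsympLeft (x.translate m).left (y.translate m).left) : S.AsympBi x y := by
  obtain ⟨k, hk⟩ := hN.exists_states_of_left h
  exact hN.asympBi_of_states hk

lemma IsNucleus.asympBi_iff {x y : E.BiPath} :
    S.AsympBi x y ↔ ∃ k : ℤ → N, ∀ n, S.Step (k n) (x.1 n) (y.1 n) (k (n + 1)) :=
  ⟨fun h => hN.exists_states_of_left fun m => (h.translate m).left,
    fun ⟨_, hk⟩ => hN.asympBi_of_states hk⟩

/-- In a regular action, runs of the nucleus automaton along long words with the same labels end in
the same state. -/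
lemma IsNucleus.exists_synchronizing [Finite A] (hreg : S.Regular) :
    ∃ n : ℕ, ∀ (k k' : ℕ → N) (x y : ℕ → A),
      (∀ i < n, S.Step (k i) (x i) (y i) (k (i + 1))) →
      (∀ i < n, S.Step (k' i) (x i) (y i) (k' (i + 1))) → k n = k' n := by
  have := hN.finite.to_subtype
  -- Otherwise there are arbitrarily long pairs of runs with the same labels and different final
  -- states. Determinism makes them differ at every earlier time too, so compactness produces an
  -- infinite pair that never merges.
  by_contra! hne
  have key : ∃ t : ℕ → (N × N) × (A × A), ∀ n,
      (S.Step (t n).1.1 (t n).2.1 (t n).2.2 (t (n + 1)).1.1 ∧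
        S.Step (t n).1.2 (t n).2.1 (t n).2.2 (t (n + 1)).1.2) ∧ (t n).1.1 ≠ (t n).1.2 := by
    refine exists_forall_of_finset (fun (n : ℕ) (t : ℕ → (N × N) × (A × A)) =>
      (S.Step (t n).1.1 (t n).2.1 (t n).2.2 (t (n + 1)).1.1 ∧
        S.Step (t n).1.2 (t n).2.1 (t n).2.2 (t (n + 1)).1.2) ∧ (t n).1.1 ≠ (t n).1.2) ?_ ?_
    · refine fun n => ⟨{n, n + 1}, fun t t' ht hs => ?_⟩
      rwa [← ht n (by simp), ← ht (n + 1) (by simp)]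
    · intro s
      obtain ⟨M, hM⟩ := s.exists_nat_subset_range
      obtain ⟨k, k', x, y, hk, hk', hkk⟩ := hne M
      refine ⟨fun i => ((k i, k' i), (x i, y i)), fun i hi => ?_⟩
      have hi' : i < M := Finset.mem_range.1 (hM hi)
      refine ⟨⟨hk i hi', hk' i hi'⟩, fun heq => hkk ?_⟩
      have : ∀ j, i ≤ j → j ≤ M → k j = k' j := by
        intro j hj
        induction j, hj using Nat.le_induction with
        | base => exact fun _ => heq
        | succ j hj ih =>
          intro hjM
          have h1 := hk j hjM
          rw [ih (by omega)] at h1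
          exact Subtype.ext (h1.eq_state (hk' j hjM))
      exact this M hi'.le le_rfl
  obtain ⟨t, ht⟩ := key
  have h1 := fun n => (ht n).1.1
  have h2 := fun n => (ht n).1.2
  -- Following the first run by the inverse of the second fixes the input word. Regularity turns
  -- some restriction of this product into a unit, so the two states agree there, a contradiction.
  have hs : ∀ n, S.Step (compArrow (t n).1.1.1 (invArrow (t n).1.2.1)) (t n).2.1 (t n).2.1
      (compArrow (t (n + 1)).1.1.1 (invArrow (t (n + 1)).1.2.1)) := fun n =>
    (h1 n).comp (h2 n).inv
  let x : E.RightPath := ⟨fun n => (t n).2.1, fun n =>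
    (h1 n).2.1.symm.trans (h1 (n + 1)).r_left.symm⟩
  obtain ⟨n, hp, -, hn⟩ := hreg (compArrow (t 0).1.1.1 (invArrow (t 0).1.2.1)) x
    (fun n => acts_initial (k := fun n => compArrow (t n).1.1.1 (invArrow (t n).1.2.1))
      fun i _ => hs i)
  rw [restr_initial (k := fun n => compArrow (t n).1.1.1 (invArrow (t n).1.2.1))
    (y := x.1) rfl (fun i _ => hs i)] at hn
  refine (ht n).2 (Subtype.ext (eq_of_compArrow_inv_eq_unit ?_ ?_ hn))
  · exact (h1 n).r_left.symm.trans (h2 n).r_left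
  · exact (h1 n).r_right.symm.trans (h2 n).r_right

end Nucleus

end SelfSimilarAction

/-! ## Path spaces -/

namespace DirGraph

variable {V : Type u} {A : Type v} {E : DirGraph V A}

lemma LeftPath.isLocallyConstant_edge (n : ℕ) :
    IsLocallyConstant fun x : E.LeftPath => x.edge n := by
  let _ : TopologicalSpace A := ⊥
  have : DiscreteTopology A := ⟨rfl⟩
  rw [IsLocallyConstant.iff_continuous]
  exact (continuous_apply n).comp continuous_induced_dom

lemma BiPath.isLocallyConstant_edge (n : ℤ) :
    IsLocallyConstant fun x : E.BiPath => x.edge n := by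
  let _ : TopologicalSpace A := ⊥
  have : DiscreteTopology A := ⟨rfl⟩
  rw [IsLocallyConstant.iff_continuous]
  exact (continuous_apply n).comp continuous_induced_dom

lemma LeftPath.continuous_iff {X : Type*} [TopologicalSpace X] {f : X → E.LeftPath} :
    Continuous f ↔ ∀ n, IsLocallyConstant fun x => (f x).edge n := by
  let _ : TopologicalSpace A := ⊥
  have : DiscreteTopology A := ⟨rfl⟩
  simp only [IsLocallyConstant.iff_continuous]
  rw [continuous_induced_rng, continuous_pi_iff]
  rfl

lemma BiPath.continuous_iff {X : Type*} [TopologicalSpace X] {f : X → E.BiPath} :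
    Continuous f ↔ ∀ n, IsLocallyConstant fun x => (f x).edge n := by
  let _ : TopologicalSpace A := ⊥
  have : DiscreteTopology A := ⟨rfl⟩
  simp only [IsLocallyConstant.iff_continuous]
  rw [continuous_induced_rng, continuous_pi_iff]
  rfl

lemma LeftPath.isClosedEmbedding_edge :
    @IsClosedEmbedding E.LeftPath (ℕ → A) _ (@Pi.topologicalSpace ℕ (fun _ => A) fun _ => ⊥)
      LeftPath.edge := by
  let _ : TopologicalSpace A := ⊥
  have : DiscreteTopology A := ⟨rfl⟩
  refine ⟨⟨⟨rfl⟩, fun x y h => LeftPath.ext h⟩, ?_⟩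
  have : Set.range (LeftPath.edge (E := E)) =
      ⋂ n : ℕ, (fun f : ℕ → A => (f (n + 1), f n)) ⁻¹' {p | E.s p.1 = E.r p.2} := by
    ext f
    simp only [Set.mem_range, Set.mem_iInter, Set.mem_preimage, Set.mem_ofPred_eq]
    exact ⟨by rintro ⟨x, rfl⟩; exact x.chain, fun h => ⟨⟨f, h⟩, rfl⟩⟩
  rw [this]
  exact isClosed_iInter fun n => (isClosed_discrete _).preimage (by fun_prop)

lemma BiPath.isClosedEmbedding_edge :
    @IsClosedEmbedding E.BiPath (ℤ → A) _ (@Pi.topologicalSpace ℤ (fun _ => A) fun _ => ⊥)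
      BiPath.edge := by
  let _ : TopologicalSpace A := ⊥
  have : DiscreteTopology A := ⟨rfl⟩
  refine ⟨⟨⟨rfl⟩, fun x y h => BiPath.ext h⟩, ?_⟩
  have : Set.range (BiPath.edge (E := E)) =
      ⋂ n : ℤ, (fun f : ℤ → A => (f n, f (n + 1))) ⁻¹' {p | E.s p.1 = E.r p.2} := by
    ext f
    simp only [Set.mem_range, Set.mem_iInter, Set.mem_preimage, Set.mem_ofPred_eq]
    exact ⟨by rintro ⟨x, rfl⟩; exact x.chain, fun h => ⟨⟨f, h⟩, rfl⟩⟩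
  rw [this]
  exact isClosed_iInter fun n => (isClosed_discrete _).preimage (by fun_prop)

instance [Finite A] : CompactSpace E.LeftPath :=
  let _ : TopologicalSpace A := ⊥
  LeftPath.isClosedEmbedding_edge.compactSpace

instance [Finite A] : CompactSpace E.BiPath :=
  let _ : TopologicalSpace A := ⊥
  BiPath.isClosedEmbedding_edge.compactSpace

instance : T2Space E.LeftPath :=
  let _ : TopologicalSpace A := ⊥
  have : DiscreteTopology A := ⟨rfl⟩
  LeftPath.isClosedEmbedding_edge.isEmbedding.t2Space

instance : T2Space E.BiPath :=
  let _ : TopologicalSpace A := ⊥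
  have : DiscreteTopology A := ⟨rfl⟩
  BiPath.isClosedEmbedding_edge.isEmbedding.t2Space

instance [Finite A] : SecondCountableTopology E.LeftPath :=
  let _ : TopologicalSpace A := ⊥
  have : DiscreteTopology A := ⟨rfl⟩
  LeftPath.isClosedEmbedding_edge.isEmbedding.secondCountableTopology

instance [Finite A] : SecondCountableTopology E.BiPath :=
  let _ : TopologicalSpace A := ⊥
  have : DiscreteTopology A := ⟨rfl⟩
  BiPath.isClosedEmbedding_edge.isEmbedding.secondCountableTopology

lemma LeftPath.continuous_shift : Continuous (LeftPath.shift (E := E)) :=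
  LeftPath.continuous_iff.2 fun n => LeftPath.isLocallyConstant_edge (n + 1)

lemma LeftPath.shift_iterate_edge (m : ℕ) (a : E.LeftPath) (i : ℕ) :
    (LeftPath.shift^[m] a).edge i = a.edge (i + m) := by
  induction m generalizing a with
  | zero => rfl
  | succ m ih => exact (ih a.shift).trans (congrArg a.edge (by omega))

lemma BiPath.continuous_left : Continuous (BiPath.left (E := E)) :=
  LeftPath.continuous_iff.2 fun _ => BiPath.isLocallyConstant_edge _

/-- The left-infinite path `⋯ x₋₂ x₋₁ f`. -/
def LeftPath.snoc (x : E.LeftPath) (f : A) (h : E.s (x.edge 0) = E.r f) : E.LeftPath where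
  edge
    | 0 => f
    | n + 1 => x.edge n
  chain
    | 0 => h
    | n + 1 => x.chain n

/-- The bi-infinite path `⋯ x₋₂ x₋₁ y₀ y₁ ⋯`. -/
def LeftPath.append (x : E.LeftPath) (y : E.RightPath) (h : E.s (x.edge 0) = E.r (y.1 0)) :
    E.BiPath where
  edge
    | Int.ofNat n => y.1 n
    | Int.negSucc n => x.edge n
  chain
    | Int.ofNat n => y.2 n
    | Int.negSucc 0 => h
    | Int.negSucc (n + 1) => x.chain n

lemma LeftPath.isOpen_setOf_edge (n : ℕ) (p : A → Prop) :
    IsOpen {x : E.LeftPath | p (x.edge n)} :=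
  LeftPath.isLocallyConstant_edge n {a | p a}

lemma LeftPath.continuous_snoc (f : A) :
    Continuous fun x : {x : E.LeftPath // E.s (x.edge 0) = E.r f} => x.1.snoc f x.2 := by
  refine LeftPath.continuous_iff.2 fun n => ?_
  cases n with
  | zero => exact IsLocallyConstant.const f
  | succ n => exact (LeftPath.isLocallyConstant_edge n).comp_continuous continuous_subtype_val

lemma LeftPath.continuous_append (y : E.RightPath) :
    Continuous fun x : {x : E.LeftPath // E.s (x.edge 0) = E.r (y.1 0)} => x.1.append y x.2 := by
  refine BiPath.continuous_iff.2 fun n => ?_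
  cases n with
  | ofNat n => exact IsLocallyConstant.const (y.1 n)
  | negSucc n => exact (LeftPath.isLocallyConstant_edge n).comp_continuous continuous_subtype_val

lemma NoSources.exists_rightPath (h : E.NoSources) (x : V) : ∃ y : E.RightPath, E.r (y.1 0) = x := by
  choose e he using h
  exact ⟨⟨fun n => Nat.rec (e x) (fun _ f => e (E.s f)) n, fun n => (he _).symm⟩, he x⟩

end DirGraph

/-! ### Topology and dynamics of the limit space and the solenoid. -/

namespace SelfSimilarAction

open DirGraph CategoryTheory

variable {V : Type u} {A : Type v} {E : DirGraph V A} [CategoryTheory.Groupoid.{w} V]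
variable {S : SelfSimilarAction E}

lemma exists_states_of_rightPath (g : GArrow V) (x : E.RightPath) (h : E.r (x.1 0) = g.1) :
    ∃ (k : ℕ → GArrow V) (y : E.RightPath), k 0 = g ∧
      ∀ i, S.Step (k i) (x.1 i) (y.1 i) (k (i + 1)) := by
  have key : ∀ (i : ℕ) (g : {g : GArrow V // E.r (x.1 i) = g.1}),
      ∃ (g' : {g : GArrow V // E.r (x.1 (i + 1)) = g.1}) (f : A), S.Step g.1 (x.1 i) f g'.1 := by
    rintro i ⟨g, hg⟩
    obtain ⟨f, g', hs⟩ := exists_step (S := S) g _ hg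
    exact ⟨⟨g', (x.2 i).symm.trans hs.2.1.symm⟩, f, hs⟩
  choose nxt f hs using key
  let k : (i : ℕ) → {g : GArrow V // E.r (x.1 i) = g.1} := fun i => Nat.rec ⟨g, h⟩ nxt i
  exact ⟨fun i => (k i).1, ⟨fun i => f i (k i), fun i =>
    (hs i (k i)).2.2.1.symm.trans (hs (i + 1) (k (i + 1))).r_right.symm⟩, rfl, fun i => hs i (k i)⟩

section Nucleus

variable {N : Set (GArrow V)} (hN : S.IsNucleus N)
include hN

/-- The pairs of paths together with a run in `N` form a closed set, and the space of state
sequences that is projected away is compact. -/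
lemma IsNucleus.isClosed_asympLeft : IsClosed {p : E.LeftPath × E.LeftPath | S.AsympLeft p.1 p.2} := by
  have := hN.finite.to_subtype
  let _ : TopologicalSpace A := ⊥
  have : DiscreteTopology A := ⟨rfl⟩
  let _ : TopologicalSpace N := ⊥
  have : DiscreteTopology N := ⟨rfl⟩
  have he : ∀ n, Continuous fun x : E.LeftPath => x.edge n := fun n =>
    (LeftPath.isLocallyConstant_edge n).continuous
  let Z : Set ((ℕ → N) × (E.LeftPath × E.LeftPath)) :=
    ⋂ n : ℕ, (fun q => (q.1 (n + 1), q.2.1.edge n, q.2.2.edge n, q.1 n)) ⁻¹'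
      {t : N × A × A × N | S.Step t.1 t.2.1 t.2.2.1 t.2.2.2}
  have hZ : IsClosed Z := isClosed_iInter fun n => (isClosed_discrete _).preimage (by fun_prop)
  convert isClosedMap_snd_of_compactSpace _ hZ using 1
  ext p
  simp only [Set.mem_ofPred_eq, hN.asympLeft_iff, Set.mem_image, Prod.exists, exists_eq_right, Z,
    Set.mem_iInter, Set.mem_preimage]

lemma IsNucleus.isClosed_asympBi : IsClosed {p : E.BiPath × E.BiPath | S.AsympBi p.1 p.2} := by
  have := hN.finite.to_subtype
  let _ : TopologicalSpace A := ⊥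
  have : DiscreteTopology A := ⟨rfl⟩
  let _ : TopologicalSpace N := ⊥
  have : DiscreteTopology N := ⟨rfl⟩
  have he : ∀ n, Continuous fun x : E.BiPath => x.edge n := fun n =>
    (BiPath.isLocallyConstant_edge n).continuous
  let Z : Set ((ℤ → N) × (E.BiPath × E.BiPath)) :=
    ⋂ n : ℤ, (fun q => (q.1 n, q.2.1.edge n, q.2.2.edge n, q.1 (n + 1))) ⁻¹'
      {t : N × A × A × N | S.Step t.1 t.2.1 t.2.2.1 t.2.2.2}
  have hZ : IsClosed Z := isClosed_iInter fun n => (isClosed_discrete _).preimage (by fun_prop)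
  convert isClosedMap_snd_of_compactSpace _ hZ using 1
  ext p
  simp only [Set.mem_ofPred_eq, hN.asympBi_iff, Set.mem_image, Prod.exists, exists_eq_right, Z,
    Set.mem_iInter, Set.mem_preimage]

variable [Finite V] [Finite A]

lemma IsNucleus.isClosedMap_mk_left : IsClosedMap (Quotient.mk S.leftSetoid) :=
  isClosedMap_quotient_mk hN.isClosed_asympLeft

lemma IsNucleus.t2Space_limitSpace : T2Space S.LimitSpace :=
  hN.isClosedMap_mk_left.t2Space continuous_quotient_mk' Quotient.mk_surjective

lemma IsNucleus.secondCountableTopology_limitSpace : SecondCountableTopology S.LimitSpace :=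
  hN.isClosedMap_mk_left.secondCountableTopology continuous_quotient_mk' Quotient.mk_surjective

lemma IsNucleus.t2Space_solenoid : T2Space S.Solenoid :=
  (isClosedMap_quotient_mk hN.isClosed_asympBi).t2Space continuous_quotient_mk'
    Quotient.mk_surjective

lemma IsNucleus.secondCountableTopology_solenoid : SecondCountableTopology S.Solenoid :=
  (isClosedMap_quotient_mk hN.isClosed_asympBi).secondCountableTopology continuous_quotient_mk'
    Quotient.mk_surjective

omit [Finite A] in
-- If `σ(a)` is equivalent to `b`, let the final state of the run read the last letter of `a` and
-- output `f`. Then `bf` is equivalent to `a`, and `b' ↦ b'f` is a continuous right inverse of the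
-- shift near `b`.
lemma IsNucleus.isOpenMap_shiftJ : IsOpenMap S.shiftJ := by
  intro U hU
  rw [← isQuotientMap_quotient_mk'.isOpen_preimage, isOpen_iff_mem_nhds]
  rintro b ⟨z, hz, hzb⟩
  obtain ⟨a, rfl⟩ := Quotient.exists_rep z
  obtain ⟨k, hk⟩ := hN.asympLeft_iff.1 (Quotient.exact hzb : S.AsympLeft a.shift b)
  obtain ⟨f, h, hs⟩ := exists_step (S := S) (k 0).1 (a.edge 0)
    ((a.chain 0).symm.trans (hk 0).2.1.symm)
  have hbf : E.s (b.edge 0) = E.r f := (hk 0).2.2.1.symm.trans hs.r_right.symm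
  have hab : S.AsympLeft a (b.snoc f hbf) := by
    refine hN.asympLeft_iff.2 ⟨fun n => Nat.rec ⟨h, hN.closed (k 0).2 hs⟩ (fun n _ => k n) n, ?_⟩
    rintro (_ | n)
    · exact hs
    · exact hk n
  have hO := (LeftPath.isOpen_setOf_edge (E := E) 0 fun a => E.s a = E.r f).isOpenMap_subtype_val _
    ((hU.preimage (continuous_quotient_mk' (s := S.leftSetoid))).preimage
      (LeftPath.continuous_snoc f))
  refine Filter.mem_of_superset (hO.mem_nhds ⟨⟨b, hbf⟩, ?_, rfl⟩) ?_
  · change Quotient.mk S.leftSetoid (b.snoc f hbf) ∈ U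
    rwa [← Quotient.sound (s := S.leftSetoid) hab]
  · rintro _ ⟨⟨b', hb'⟩, hb'U, rfl⟩
    exact ⟨_, hb'U, rfl⟩

omit [Finite A] in
-- The same argument as for the shift, with the final state reading the whole right half of `x`; its
-- output `y` can be appended to every left path near `b`.
lemma IsNucleus.isOpenMap_proj : IsOpenMap S.proj := by
  intro U hU
  rw [← isQuotientMap_quotient_mk'.isOpen_preimage, isOpen_iff_mem_nhds]
  rintro b ⟨z, hz, hzb⟩
  obtain ⟨x, rfl⟩ := Quotient.exists_rep z
  obtain ⟨k, hk⟩ := hN.asympLeft_iff.1 (Quotient.exact hzb : S.AsympLeft x.left b)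
  obtain ⟨l, y, hl0, hl⟩ := exists_states_of_rightPath (S := S) (k 0).1 (x.tail 0)
    ((x.chain (-1)).symm.trans (hk 0).2.1.symm)
  have hlN : ∀ i, l i ∈ N := by
    intro i
    induction i with
    | zero => rw [hl0]; exact (k 0).2
    | succ i ih => exact hN.closed ih (hl i)
  have hby : E.s (b.edge 0) = E.r (y.1 0) := by
    rw [(hl 0).r_right, hl0, (hk 0).2.2.1]
  have hxb : S.AsympBi x (b.append y hby) := by
    refine hN.asympBi_of_states (k := fun n => match n with
      | Int.ofNat n => ⟨l n, hlN n⟩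
      | Int.negSucc n => k (n + 1)) ?_
    rintro (n | _ | n)
    · have := hl n
      simp only [BiPath.tail, zero_add] at this
      exact this
    · have := hk 0
      rw [← hl0] at this
      exact this
    · exact hk (n + 1)
  have hO := (LeftPath.isOpen_setOf_edge (E := E) 0
    fun a => E.s a = E.r (y.1 0)).isOpenMap_subtype_val _
      ((hU.preimage (continuous_quotient_mk' (s := S.biSetoid))).preimage
        (LeftPath.continuous_append y))
  refine Filter.mem_of_superset (hO.mem_nhds ⟨⟨b, hby⟩, ?_, rfl⟩) ?_
  · change Quotient.mk S.biSetoid (b.append y hby) ∈ U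
    rwa [← Quotient.sound (s := S.biSetoid) hxb]
  · rintro _ ⟨⟨b', hb'⟩, hb'U, rfl⟩
    exact ⟨_, hb'U, rfl⟩

/-- Near the diagonal of the limit space, the last letters of any two representatives are related by
a run of the nucleus automaton. -/
lemma IsNucleus.exists_states_mem_nhds (n : ℕ) (x : S.LimitSpace) :
    {p : S.LimitSpace × S.LimitSpace | ∀ a b : E.LeftPath, Quotient.mk S.leftSetoid a = p.1 →
      Quotient.mk S.leftSetoid b = p.2 →
      ∃ k : ℕ → N, ∀ i < n, S.Step (k (i + 1)) (a.edge i) (b.edge i) (k i)} ∈ 𝓝 (x, x) := by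
  let W : Set E.LeftPath :=
    {a | ∃ a' : E.LeftPath, Quotient.mk S.leftSetoid a' = x ∧ ∀ i < n, a.edge i = a'.edge i}
  have hW : IsOpen W := by
    have : W = ⋃ a' ∈ {a' | Quotient.mk S.leftSetoid a' = x},
        ⋂ i ∈ Set.Iio n, {a : E.LeftPath | a.edge i = a'.edge i} := by
      ext a; simp [W]
    rw [this]
    exact isOpen_biUnion fun a' _ => (Set.finite_Iio n).isOpen_biInter fun i _ =>
      LeftPath.isOpen_setOf_edge i fun e => e = a'.edge i
  have hmem : W ∈ Filter.comap (Quotient.mk S.leftSetoid) (𝓝 x) := by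
    -- The quotient map is closed, so the neighbourhood `W` of the fibre over `x` contains the
    -- preimage of a neighbourhood of `x`; this controls all representatives at once.
    rw [hN.isClosedMap_mk_left.comap_nhds_eq continuous_quotient_mk', hW.mem_nhdsSet]
    exact fun a ha => ⟨a, ha, fun _ _ => rfl⟩
  obtain ⟨U, hU, hUW⟩ := hmem
  refine Filter.mem_of_superset (prod_mem_nhds hU hU) ?_
  rintro ⟨y, z⟩ ⟨hy, hz⟩ a b rfl rfl
  obtain ⟨a', ha', hai⟩ := hUW hy
  obtain ⟨b', hb', hbi⟩ := hUW hz
  obtain ⟨k, hk⟩ := hN.asympLeft_iff.1 (Quotient.exact (ha'.trans hb'.symm) : S.AsympLeft a' b')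
  refine ⟨k, fun i hi => ?_⟩
  rw [hai i hi, hbi i hi]
  exact hk i

omit hN [Finite A] in
lemma shiftJ_iterate_mk (m : ℕ) (a : E.LeftPath) :
    S.shiftJ^[m] (Quotient.mk S.leftSetoid a) = Quotient.mk S.leftSetoid (LeftPath.shift^[m] a) := by
  induction m generalizing a with
  | zero => rfl
  | succ m ih => exact ih a.shift

/-- The shift on the limit space of a regular action is positively expansive. -/
lemma IsNucleus.exists_expansive (hreg : S.Regular) :
    ∃ O : Set (S.LimitSpace × S.LimitSpace), (∀ x, O ∈ 𝓝 (x, x)) ∧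
      ∀ x y, (∀ m : ℕ, (S.shiftJ^[m] x, S.shiftJ^[m] y) ∈ O) → x = y := by
  obtain ⟨n, hn⟩ := hN.exists_synchronizing hreg
  refine ⟨_, hN.exists_states_mem_nhds (n + 1), fun x y h => ?_⟩
  obtain ⟨a, rfl⟩ := Quotient.exists_rep x
  obtain ⟨b, rfl⟩ := Quotient.exists_rep y
  have h' : ∀ m : ℕ, ∃ k : ℕ → N, ∀ i < n + 1,
      S.Step (k (i + 1)) (a.edge (i + m)) (b.edge (i + m)) (k i) := by
    intro m
    obtain ⟨k, hk⟩ := h m _ _ (shiftJ_iterate_mk m a).symm (shiftJ_iterate_mk m b).symm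
    refine ⟨k, fun i hi => ?_⟩
    have := hk i hi
    rwa [LeftPath.shift_iterate_edge, LeftPath.shift_iterate_edge] at this
  choose k hk using h'
  -- Consecutive windows of length `n + 1` share `n` letters, exactly the synchronization length.
  -- Both runs read the shared letters, so their states agree at the right end of the overlap, and
  -- the states `k m 0` form one infinite run.
  have hsync : ∀ m, k m 1 = k (m + 1) 0 := by
    intro m
    have := hn (fun i => k m (n + 1 - i)) (fun i => k (m + 1) (n - i))
      (fun i => a.edge (n - i + m)) (fun i => b.edge (n - i + m)) (fun i hi => ?_) (fun i hi => ?_)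
    · simpa using this
    · have h1 := hk m (n - i) (by omega)
      rw [show n - i + 1 = n + 1 - i by omega] at h1
      rwa [show n + 1 - (i + 1) = n - i by omega]
    · have h1 := hk (m + 1) (n - (i + 1)) (by omega)
      rwa [show n - (i + 1) + 1 = n - i by omega,
        show n - (i + 1) + (m + 1) = n - i + m by omega] at h1
  refine Quotient.sound (s := S.leftSetoid) (hN.asympLeft_iff.2 ⟨fun m => k m 0, fun m => ?_⟩)
  have := hk m 0 n.succ_pos
  rw [zero_add, zero_add, hsync] at this
  exact this

omit [Finite A] in
-- The projection of `τ̃⁻ᵐ` remembers the letters before position `m`. Thus the solenoid embeds as a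
-- set into the inverse limit of the limit space under its shift.
lemma IsNucleus.eq_of_proj_symm_iterate {ξ η : S.Solenoid}
    (h : ∀ m : ℕ, S.proj (S.tau.symm^[m] ξ) = S.proj (S.tau.symm^[m] η)) : ξ = η := by
  obtain ⟨x, rfl⟩ := Quotient.exists_rep ξ
  obtain ⟨y, rfl⟩ := Quotient.exists_rep η
  have key : ∀ (m : ℕ) (x : E.BiPath), S.tau.symm^[m] (Quotient.mk S.biSetoid x) =
      Quotient.mk S.biSetoid (x.translate m) := by
    intro m
    induction m with
    | zero =>
      exact fun x => congrArg (Quotient.mk S.biSetoid)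
        (BiPath.ext (funext fun n => congrArg x.1 (by simp)))
    | succ m ih =>
      intro x
      rw [Function.iterate_succ_apply]
      refine (ih (x.translate 1)).trans (congrArg (Quotient.mk S.biSetoid)
        (BiPath.ext (funext fun n => congrArg x.1 ?_)))
      push_cast; ring
  refine Quotient.sound (s := S.biSetoid) (hN.asympBi_of_left fun m => ?_)
  have := h m
  rw [key, key] at this
  exact Quotient.exact this

end Nucleus

variable [Finite V]

lemma continuous_shiftJ : Continuous S.shiftJ :=
  Continuous.quotient_map' (s := S.leftSetoid) (t := S.leftSetoid) LeftPath.continuous_shift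
    fun _ _ h => AsympLeft.shift h

lemma continuous_proj : Continuous S.proj :=
  Continuous.quotient_map' (s := S.biSetoid) (t := S.leftSetoid) BiPath.continuous_left
    fun _ _ h => AsympBi.left h

lemma surjective_proj (hE : E.NoSources) : Function.Surjective S.proj := by
  intro z
  obtain ⟨a, rfl⟩ := Quotient.exists_rep z
  obtain ⟨y, hy⟩ := hE.exists_rightPath (E.s (a.edge 0))
  exact ⟨Quotient.mk S.biSetoid (a.append y hy.symm), rfl⟩

lemma proj_tau (ξ : S.Solenoid) : S.proj (S.tau ξ) = S.shiftJ (S.proj ξ) := by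
  obtain ⟨x, rfl⟩ := Quotient.exists_rep ξ
  refine congrArg (Quotient.mk S.leftSetoid) (LeftPath.ext (funext fun n => congrArg x.1 ?_))
  push_cast; ring

end SelfSimilarAction

/-! ## Topological groupoids -/

namespace ArrowGroupoid

lemma IsTopological.amplify {X Y Γ : Type*} [TopologicalSpace X] [TopologicalSpace Y]
    [TopologicalSpace Γ] {H : ArrowGroupoid Y Γ} (hH : H.IsTopological) {π : X → Y}
    (hπ : Continuous π) : (H.amplify π).IsTopological where
  continuous_r := continuous_fst.comp continuous_subtype_val
  continuous_s := continuous_snd.comp (continuous_snd.comp continuous_subtype_val)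
  continuous_unit := by
    refine Continuous.subtype_mk ?_ _
    exact continuous_id.prodMk ((hH.continuous_unit.comp hπ).prodMk continuous_id)
  continuous_inv := by
    refine Continuous.subtype_mk ?_ _
    have := hH.continuous_inv
    fun_prop
  continuous_mul := by
    refine Continuous.subtype_mk ?_ _
    refine (by fun_prop : Continuous _).prodMk (Continuous.prodMk ?_ (by fun_prop))
    let f : {p : Amplification H π × Amplification H π //
        (H.amplify π).s p.1 = (H.amplify π).r p.2} → {p : Γ × Γ // H.s p.1 = H.r p.2} :=
      fun p => ⟨(p.1.1.1.2.1, p.1.2.1.2.1), p.1.1.2.2.trans ((congrArg π p.2).trans p.1.2.2.1.symm)⟩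
    have hf : Continuous f := by
      refine Continuous.subtype_mk ?_ _
      fun_prop
    exact hH.continuous_mul.comp hf

lemma IsTopological.of_iso {X Y Γ Δ : Type*} [TopologicalSpace X] [TopologicalSpace Y]
    [TopologicalSpace Γ] [TopologicalSpace Δ] {G : ArrowGroupoid X Γ} {H : ArrowGroupoid Y Δ}
    (hH : H.IsTopological) (κ : TopGroupoidIso G H)
    (hunit : ∀ x, κ.onArrows (G.unit x) = H.unit (κ.onUnits x))
    (hinv : ∀ a, κ.onArrows (G.inv a) = H.inv (κ.onArrows a)) : G.IsTopological where
  continuous_r := by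
    rw [← κ.onUnits.comp_continuous_iff]
    convert hH.continuous_r.comp κ.onArrows.continuous using 1
    exact funext fun a => (κ.map_r a).symm
  continuous_s := by
    rw [← κ.onUnits.comp_continuous_iff]
    convert hH.continuous_s.comp κ.onArrows.continuous using 1
    exact funext fun a => (κ.map_s a).symm
  continuous_unit := by
    rw [← κ.onArrows.comp_continuous_iff]
    convert hH.continuous_unit.comp κ.onUnits.continuous using 1
    exact funext hunit
  continuous_inv := by
    rw [← κ.onArrows.comp_continuous_iff]
    convert hH.continuous_inv.comp κ.onArrows.continuous using 1
    exact funext hinv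
  continuous_mul := by
    rw [← κ.onArrows.comp_continuous_iff]
    let f : {p : Γ × Γ // G.s p.1 = G.r p.2} → {p : Δ × Δ // H.s p.1 = H.r p.2} := fun p =>
      ⟨(κ.onArrows p.1.1, κ.onArrows p.1.2),
        (κ.map_s _).trans ((congrArg κ.onUnits p.2).trans (κ.map_r _).symm)⟩
    have hf : Continuous f := by
      refine Continuous.subtype_mk ?_ _
      have := κ.onArrows.continuous
      fun_prop
    convert hH.continuous_mul.comp hf using 1
    exact funext fun p => κ.map_mul _ _ p.2

end ArrowGroupoid

/-! ### Locally injective maps. -/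

lemma exists_mem_nhds_injOn_iterate {X : Type*} [TopologicalSpace X] {T : X → X}
    (hc : Continuous T) (hT : ∀ x, ∃ U ∈ 𝓝 x, Set.InjOn T U) (n : ℕ) (x : X) :
    ∃ U ∈ 𝓝 x, Set.InjOn T^[n] U := by
  induction n generalizing x with
  | zero => exact ⟨Set.univ, Filter.univ_mem, Function.injective_id.injOn⟩
  | succ n ih =>
    obtain ⟨U, hU, hUT⟩ := hT x
    obtain ⟨W, hW, hWT⟩ := ih (T x)
    exact ⟨U ∩ T ⁻¹' W, Filter.inter_mem hU (hc.continuousAt hW), fun y hy z hz h =>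
      hUT hy.1 hz.1 (hWT hy.2 hz.2 h)⟩

lemma isLocalHomeomorph_of_isOpenMap {X Y : Type*} [TopologicalSpace X] [TopologicalSpace Y]
    {f : X → Y} (hc : Continuous f) (ho : IsOpenMap f) (hf : ∀ x, ∃ U ∈ 𝓝 x, Set.InjOn f U) :
    IsLocalHomeomorph f := by
  rw [isLocalHomeomorph_iff_isOpenEmbedding_restrict]
  intro x
  obtain ⟨U, hU, hUf⟩ := hf x
  refine ⟨interior U, interior_mem_nhds.2 hU, ?_⟩
  exact IsOpenEmbedding.of_continuous_injective_isOpenMap (hc.comp continuous_subtype_val)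
    (hUf.mono interior_subset).injective (ho.domRestrict isOpen_interior)

/-! ## The topology of a Deaconu–Renault groupoid -/

namespace DeaconuRenault

variable {X : Type u} [TopologicalSpace X] {T : X → X}

lemma isOpen_basicSet {U W : Set X} (hU : IsOpen U) (hW : IsOpen W) (m n : ℕ) :
    IsOpen (basicSet (T := T) U m n W) :=
  TopologicalSpace.isOpen_generateFrom_of_mem ⟨U, m, n, W, hU, hW, rfl⟩

lemma continuous_rng : Continuous (rng : DeaconuRenault T → X) := by
  refine continuous_iff_continuousAt.2 fun g => tendsto_nhds.2 fun U hU hg => ?_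
  obtain ⟨m, n, hl, he⟩ := g.cond
  exact Filter.mem_of_superset ((isOpen_basicSet hU isOpen_univ m n).mem_nhds
    (show g ∈ _ from ⟨hg, hl, trivial, he⟩)) fun _ h => h.1

lemma continuous_src : Continuous (src : DeaconuRenault T → X) := by
  refine continuous_iff_continuousAt.2 fun g => tendsto_nhds.2 fun U hU hg => ?_
  obtain ⟨m, n, hl, he⟩ := g.cond
  exact Filter.mem_of_superset ((isOpen_basicSet isOpen_univ hU m n).mem_nhds
    (show g ∈ _ from ⟨trivial, hl, hg, he⟩)) fun _ h => h.2.2.1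

lemma eventually_cond {g : DeaconuRenault T} {m n : ℕ} (hl : g.lag = (m : ℤ) - n)
    (he : T^[m] g.rng = T^[n] g.src) :
    ∀ᶠ g' in 𝓝 g, g'.lag = (m : ℤ) - n ∧ T^[m] g'.rng = T^[n] g'.src :=
  Filter.mem_of_superset ((isOpen_basicSet isOpen_univ isOpen_univ m n).mem_nhds
    (show g ∈ _ from ⟨trivial, hl, trivial, he⟩)) fun _ h => ⟨h.2.1, h.2.2.2⟩

lemma continuous_lag : Continuous (lag : DeaconuRenault T → ℤ) := by
  refine continuous_iff_continuousAt.2 fun g => ?_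
  obtain ⟨m, n, hl, he⟩ := g.cond
  refine (continuousAt_const (y := g.lag)).congr ?_
  filter_upwards [eventually_cond hl he] with g' hg'
  rw [hl, hg'.1]

variable (hc : Continuous T) (hT : ∀ x, ∃ U ∈ 𝓝 x, Set.InjOn T U)
include hc hT

/-- For a locally injective map `T`, a map into the groupoid that stays in one of the sets
`T^m(x) = T^n(y)` is continuous as soon as its range and source are. -/
lemma continuousAt_of_eventually {Z : Type*} [TopologicalSpace Z] {f : Z → DeaconuRenault T} {z : Z}
    (hr : ContinuousAt (fun z => (f z).rng) z) (hs : ContinuousAt (fun z => (f z).src) z) {m n : ℕ}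
    (h : ∀ᶠ z' in 𝓝 z, (f z').lag = (m : ℤ) - n ∧ T^[m] (f z').rng = T^[n] (f z').src) :
    ContinuousAt f z := by
  refine TopologicalSpace.tendsto_nhds_generateFrom_iff.2 ?_
  rintro _ ⟨U, m', n', W, hU, hW, rfl⟩ ⟨hx, hl, hy, he⟩
  have hmn : (m : ℤ) - n = m' - n' := h.self_of_nhds.1.symm.trans hl
  -- Equal lags mean that the two pairs of exponents differ by a common shift `j`. Raising the
  -- exponents is immediate. Lowering them cancels `T^j`, which is injective near the common value
  -- `T^[m'] (f z).rng = T^[n'] (f z).src`.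
  have key : ∀ᶠ z' in 𝓝 z, T^[m'] (f z').rng = T^[n'] (f z').src := by
    rcases le_total m m' with hm | hm
    · obtain ⟨j, rfl⟩ := Nat.exists_eq_add_of_le' hm
      obtain rfl : n' = j + n := by omega
      filter_upwards [h] with z' hz'
      rw [Function.iterate_add_apply, hz'.2, ← Function.iterate_add_apply]
    · obtain ⟨j, rfl⟩ := Nat.exists_eq_add_of_le' hm
      obtain rfl : n = j + n' := by omega
      obtain ⟨O, hO, hOT⟩ := exists_mem_nhds_injOn_iterate hc hT j (T^[m'] (f z).rng)
      have h1 : ∀ᶠ z' in 𝓝 z, T^[m'] (f z').rng ∈ O :=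
        ((hc.iterate m').continuousAt.comp hr).eventually hO
      have h2 : ∀ᶠ z' in 𝓝 z, T^[n'] (f z').src ∈ O := by
        rw [he] at hO
        exact ((hc.iterate n').continuousAt.comp hs).eventually hO
      filter_upwards [h, h1, h2] with z' hz' hz1 hz2
      refine hOT hz1 hz2 ?_
      rw [← Function.iterate_add_apply, ← Function.iterate_add_apply]
      exact hz'.2
  filter_upwards [h, key, hr.eventually (hU.mem_nhds hx), hs.eventually (hW.mem_nhds hy)]
    with z' h1 h2 h3 h4
  exact ⟨h3, h1.1.trans hmn, h4, h2⟩

lemma isTopological_groupoid : (DeaconuRenault.groupoid T).IsTopological where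
  continuous_r := continuous_rng
  continuous_s := continuous_src
  continuous_unit := continuous_iff_continuousAt.2 fun x =>
    continuousAt_of_eventually hc hT (m := 0) (n := 0) continuousAt_id continuousAt_id
      (Filter.Eventually.of_forall fun _ => ⟨by simp [groupoid], rfl⟩)
  continuous_inv := by
    refine continuous_iff_continuousAt.2 fun g => ?_
    obtain ⟨m, n, hl, he⟩ := g.cond
    refine continuousAt_of_eventually hc hT (m := n) (n := m) continuous_src.continuousAt
      continuous_rng.continuousAt ?_
    filter_upwards [eventually_cond hl he] with g' hg'
    refine ⟨?_, hg'.2.symm⟩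
    change -g'.lag = _
    rw [hg'.1]; ring
  continuous_mul := by
    refine continuous_iff_continuousAt.2 fun p => ?_
    obtain ⟨m, n, hl, he⟩ := p.1.1.cond
    obtain ⟨m', n', hl', he'⟩ := p.1.2.cond
    refine continuousAt_of_eventually hc hT (m := m' + m) (n := n + n')
      (continuous_rng.comp (continuous_fst.comp continuous_subtype_val)).continuousAt
      (continuous_src.comp (continuous_snd.comp continuous_subtype_val)).continuousAt ?_
    filter_upwards [(continuous_fst.comp continuous_subtype_val).continuousAt.eventually
      (eventually_cond hl he), (continuous_snd.comp continuous_subtype_val).continuousAt.eventually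
      (eventually_cond hl' he')]
    rintro ⟨⟨a, b⟩, hab⟩ ⟨h1, h2⟩ ⟨h3, h4⟩
    replace hab : a.src = b.rng := hab
    dsimp only [Function.comp_apply] at h1 h2 h3 h4
    constructor
    · change a.lag + b.lag = _
      rw [h1, h3]; push_cast; ring
    · change T^[m' + m] a.rng = T^[n + n'] b.src
      rw [Function.iterate_add_apply, h2, hab, ← Function.iterate_add_apply, Nat.add_comm m' n,
        Function.iterate_add_apply, h4, ← Function.iterate_add_apply]

end DeaconuRenault

/-! ## Compatible metrics -/

namespace CompatibleMetric

variable {X : Type u} [TopologicalSpace X] (d : CompatibleMetric X)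

lemma eventually_dist_lt (x : X) {ε : ℝ} (hε : 0 < ε) : ∀ᶠ y in 𝓝 x, d.dist x y < ε := by
  refine IsOpen.mem_nhds ((d.isOpen_iff _).2 fun y hy => ⟨ε - d.dist x y, sub_pos.2 hy,
    fun z hz => ?_⟩) (by simpa [d.dist_self] using hε)
  have := d.dist_triangle x y z
  change d.dist x z < ε
  linarith

lemma continuous_dist : Continuous fun p : X × X => d.dist p.1 p.2 := by
  refine continuous_iff_continuousAt.2 fun ⟨x, y⟩ => Metric.tendsto_nhds.2 fun ε hε => ?_
  filter_upwards [prod_mem_nhds (d.eventually_dist_lt x (half_pos hε))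
    (d.eventually_dist_lt y (half_pos hε))]
  rintro ⟨x', y'⟩ ⟨hx, hy⟩
  replace hx : d.dist x x' < ε / 2 := hx
  replace hy : d.dist y y' < ε / 2 := hy
  have h1 := d.dist_triangle x' x y'
  have h2 := d.dist_triangle x y y'
  have h3 := d.dist_triangle x x' y
  have h4 := d.dist_triangle x' y' y
  rw [d.dist_comm x' x] at h1
  rw [d.dist_comm y' y] at h4
  rw [Real.dist_eq, abs_lt]
  constructor <;> dsimp only <;> linarith

/-- A Lebesgue number argument: the closed sets where the distance is at most `1 / (n + 1)` decrease
to the diagonal. -/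
lemma exists_forall_dist_lt [CompactSpace X] {W : Set (X × X)} (hW : ∀ x, W ∈ 𝓝 (x, x)) :
    ∃ ε > 0, ∀ x y, d.dist x y < ε → (x, y) ∈ W := by
  obtain ⟨n, hn⟩ := exists_subset_of_antitone_of_isClosed
    (C := fun n : ℕ => {p : X × X | d.dist p.1 p.2 ≤ 1 / ((n : ℝ) + 1)})
    (fun n => isClosed_le d.continuous_dist continuous_const)
    (fun m n hmn p hp => le_trans (α := ℝ) hp (Nat.one_div_le_one_div hmn))
    (isOpen_interior (s := W)) (by
      rintro ⟨x, y⟩ h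
      have h0 : d.dist x y ≤ 0 := ge_of_tendsto' tendsto_one_div_add_atTop_nhds_zero_nat
        fun n => Set.mem_iInter.1 h n
      obtain rfl := d.eq_of_dist_eq_zero x y (le_antisymm h0 (d.dist_nonneg x y))
      exact mem_interior_iff_mem_nhds.2 (hW x))
  exact ⟨_, Nat.one_div_pos_of_nat (n := n), fun x y hxy =>
    interior_subset (hn (le_of_lt (α := ℝ) hxy))⟩

end CompatibleMetric

/-! ## The stable Ruelle groupoid of an extension -/

section Extension

variable {X : Type u} {Y : Type v} [TopologicalSpace X] {φ : X ≃ₜ X}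
  {T : Y → Y} {π : X → Y}

/-- The closed relations `π(φ⁻ᵐ x) = π(φ⁻ᵐ y)` decrease in `m` by the semiconjugacy and intersect in
the diagonal by `hsep`, so one of them lies in `W`. The map `φ^m` carries pairs in a common fibre of
`π` into the `m`-th relation. -/
lemma exists_forall_iterate_mem [TopologicalSpace Y] [CompactSpace X] [T2Space Y] (hc : Continuous π)
    (hπ : ∀ x, π (φ x) = T (π x))
    (hsep : ∀ x y, (∀ m : ℕ, π (φ.symm^[m] x) = π (φ.symm^[m] y)) → x = y)
    {W : Set (X × X)} (hW : IsOpen W) (hdiag : ∀ x, (x, x) ∈ W) :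
    ∃ K : ℕ, ∀ m ≥ K, ∀ x y, π x = π y → (φ^[m] x, φ^[m] y) ∈ W := by
  have hanti : Antitone fun m : ℕ => {p : X × X | π (φ.symm^[m] p.1) = π (φ.symm^[m] p.2)} := by
    refine antitone_nat_of_succ_le fun m p hp => ?_
    have h : ∀ x, φ.symm^[m] x = φ (φ.symm^[m + 1] x) := fun x => by
      rw [Function.iterate_succ_apply', φ.apply_symm_apply]
    change π (φ.symm^[m + 1] p.1) = π (φ.symm^[m + 1] p.2) at hp
    change π (φ.symm^[m] p.1) = π (φ.symm^[m] p.2)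
    rw [h, h, hπ, hπ, hp]
  obtain ⟨K, hK⟩ := exists_subset_of_antitone_of_isClosed (fun m => isClosed_eq
      (hc.comp ((φ.symm.continuous.iterate m).comp continuous_fst))
      (hc.comp ((φ.symm.continuous.iterate m).comp continuous_snd))) hanti hW (by
    rintro ⟨x, y⟩ h
    obtain rfl := hsep x y fun m => Set.mem_iInter.1 h m
    exact hdiag x)
  refine ⟨K, fun m hm x y hxy => hK (hanti hm ?_)⟩
  change π (φ.symm^[m] (φ^[m] x)) = π (φ.symm^[m] (φ^[m] y))
  have h : Function.LeftInverse φ.symm^[m] φ^[m] := φ.left_inv.iterate m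
  rw [h x, h y, hxy]

variable {d : CompatibleMetric X} {ε : ℝ}

/-- Expansivity applied to the orbits from time `M` on. Its point is that the exponent `M` serves
the whole level. -/
lemma iterate_eq_of_mem_stableLevel (hπ : ∀ x, π (φ x) = T (π x))
    (hexp : ∀ x y, (∀ m : ℕ, d.dist (φ^[m] x) (φ^[m] y) < ε) → π x = π y) {p : X × X} {M : ℕ}
    (hp : p ∈ stableLevel d φ ε M) : T^[M] (π p.1) = T^[M] (π p.2) := by
  have h := (show Function.Semiconj π φ T from hπ).iterate_right M
  rw [← h, ← h]
  refine hexp _ _ fun m => ?_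
  rw [← Function.iterate_add_apply, ← Function.iterate_add_apply]
  exact hp _ (Nat.le_add_left _ _)

/-- At time `M` the two points lie in one fibre of `π`, and after `K` more steps fibres have
diameter below `ε`. The new level depends on `M` only, as continuity of the inverse isomorphism
requires. -/
lemma mem_stableLevel_of_iterate_eq (hπ : ∀ x, π (φ x) = T (π x)) {K : ℕ}
    (hK : ∀ m ≥ K, ∀ x y, π x = π y → d.dist (φ^[m] x) (φ^[m] y) < ε) {p : X × X} {M : ℕ}
    (hp : T^[M] (π p.1) = T^[M] (π p.2)) : p ∈ stableLevel d φ ε (K + M) := by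
  have h := (show Function.Semiconj π φ T from hπ).iterate_right M
  intro m hm
  have := hK (m - M) (by omega) (φ^[M] p.1) (φ^[M] p.2) (by rw [h, h, hp])
  rwa [← Function.iterate_add_apply, ← Function.iterate_add_apply, Nat.sub_add_cancel (by omega)]
    at this

lemma mem_stableSet_of_iterate_eq (hπ : ∀ x, π (φ x) = T (π x))
    (hcontr : ∀ δ > 0, ∃ K : ℕ, ∀ m ≥ K, ∀ x y, π x = π y → d.dist (φ^[m] x) (φ^[m] y) < δ)
    {p : X × X} {M : ℕ} (hp : T^[M] (π p.1) = T^[M] (π p.2)) : p ∈ stableSet d φ := by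
  refine Metric.tendsto_atTop.2 fun δ hδ => ?_
  obtain ⟨K, hK⟩ := hcontr δ hδ
  refine ⟨K + M, fun m hm => ?_⟩
  rw [Real.dist_eq, sub_zero, abs_of_nonneg (d.dist_nonneg _ _)]
  exact mem_stableLevel_of_iterate_eq hπ hK hp m hm

lemma exists_mem_stableLevel (hε : 0 < ε) {p : X × X} (hp : p ∈ stableSet d φ) :
    ∃ M, p ∈ stableLevel d φ ε M :=
  Filter.eventually_atTop.1 ((show Filter.Tendsto _ _ _ from hp).eventually (gt_mem_nhds hε))

lemma stableSet_eq_iUnion_stableLevel (hε : 0 < ε) (hπ : ∀ x, π (φ x) = T (π x))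
    (hexp : ∀ x y, (∀ m : ℕ, d.dist (φ^[m] x) (φ^[m] y) < ε) → π x = π y)
    (hcontr : ∀ δ > 0, ∃ K : ℕ, ∀ m ≥ K, ∀ x y, π x = π y → d.dist (φ^[m] x) (φ^[m] y) < δ) :
    stableSet d φ = ⋃ M : ℕ, stableLevel d φ ε M := by
  ext p
  rw [Set.mem_iUnion]
  refine ⟨exists_mem_stableLevel hε, fun ⟨M, hM⟩ => ?_⟩
  exact mem_stableSet_of_iterate_eq hπ hcontr (iterate_eq_of_mem_stableLevel hπ hexp hM)

lemma iterate_zpow_apply {m k : ℕ} {n : ℤ} (h : n = (m : ℤ) - k) (x : X) :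
    φ^[k] ((φ.toEquiv ^ n : Equiv.Perm X) x) = φ^[m] x := by
  have e : ∀ (j : ℕ) (y : X), φ^[j] y = (φ.toEquiv ^ (j : ℤ) : Equiv.Perm X) y := fun j y => by
    rw [zpow_natCast, ← Equiv.Perm.iterate_eq_pow]; rfl
  rw [e, e, ← Equiv.Perm.mul_apply, ← zpow_add, h]
  congr 2
  ring

lemma iterate_proj_zpow (hπ : ∀ x, π (φ x) = T (π x)) {m k : ℕ} {n : ℤ} (h : n = (m : ℤ) - k)
    (x : X) : T^[k] (π ((φ.toEquiv ^ n : Equiv.Perm X) x)) = T^[m] (π x) := by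
  have hs := (show Function.Semiconj π φ T from hπ).iterate_right
  rw [← hs k, iterate_zpow_apply h, hs m]

lemma continuous_zpow_toEquiv (n : ℤ) : Continuous (φ.toEquiv ^ n : Equiv.Perm X) := by
  cases n with
  | ofNat n =>
    rw [Int.ofNat_eq_natCast, zpow_natCast, ← Equiv.Perm.iterate_eq_pow]
    exact φ.continuous.iterate n
  | negSucc n =>
    rw [zpow_negSucc, ← inv_pow, ← Equiv.Perm.iterate_eq_pow]
    exact φ.symm.continuous.iterate (n + 1)

variable (T) in
lemma zpow_mem_stableSet_iff (hε : 0 < ε) (hπ : ∀ x, π (φ x) = T (π x))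
    (hexp : ∀ x y, (∀ m : ℕ, d.dist (φ^[m] x) (φ^[m] y) < ε) → π x = π y)
    (hcontr : ∀ δ > 0, ∃ K : ℕ, ∀ m ≥ K, ∀ x y, π x = π y → d.dist (φ^[m] x) (φ^[m] y) < δ)
    {n : ℤ} {x y : X} : ((φ.toEquiv ^ n : Equiv.Perm X) x, y) ∈ stableSet d φ ↔
      ∃ m k : ℕ, n = (m : ℤ) - k ∧ T^[m] (π x) = T^[k] (π y) := by
  constructor
  · intro h
    obtain ⟨M, hM⟩ := exists_mem_stableLevel hε h
    have h1 := iterate_eq_of_mem_stableLevel hπ hexp hM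
    -- Write `n` as the difference of the natural numbers `n + |n|` and `|n|`, then add `M` to both
    -- so that the second exponent is at least `M`.
    have h2 : n = (((n + n.natAbs).toNat + M : ℕ) : ℤ) - (n.natAbs + M : ℕ) := by
      omega
    refine ⟨_, _, h2, ?_⟩
    rw [← iterate_proj_zpow hπ h2, Function.iterate_add_apply, h1, ← Function.iterate_add_apply]
  · rintro ⟨m, k, hn, h⟩
    refine mem_stableSet_of_iterate_eq hπ hcontr (M := k) ?_
    rw [iterate_proj_zpow hπ hn, h]

/-- The bijection `(ξ, n, η) ↦ (ξ, (π(ξ), n, π(η)), η)` from the stable Ruelle groupoid to the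
amplification of the Deaconu–Renault groupoid. -/
def stableRuelleEquiv (hε : 0 < ε) (hπ : ∀ x, π (φ x) = T (π x))
    (hexp : ∀ x y, (∀ m : ℕ, d.dist (φ^[m] x) (φ^[m] y) < ε) → π x = π y)
    (hcontr : ∀ δ > 0, ∃ K : ℕ, ∀ m ≥ K, ∀ x y, π x = π y → d.dist (φ^[m] x) (φ^[m] y) < δ) :
    StableRuelle d φ ε ≃ Amplification (DeaconuRenault.groupoid T) π where
  toFun g := ⟨(g.rng, ⟨π g.rng, g.lag, π g.src,
    (zpow_mem_stableSet_iff T hε hπ hexp hcontr).1 g.mem⟩, g.src), rfl, rfl⟩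
  invFun p := ⟨p.1.1, p.1.2.1.lag, p.1.2.2, by
    refine (zpow_mem_stableSet_iff T hε hπ hexp hcontr).2 ?_
    have := p.1.2.1.cond
    rwa [show p.1.2.1.rng = π p.1.1 from p.2.1, show p.1.2.1.src = π p.1.2.2 from p.2.2] at this⟩
  left_inv _ := rfl
  right_inv p := Subtype.ext (Prod.ext rfl (Prod.ext
    (DeaconuRenault.ext p.2.1.symm rfl p.2.2.symm) rfl))

section

variable (hε : 0 < ε) (hπ : ∀ x, π (φ x) = T (π x))
    (hexp : ∀ x y, (∀ m : ℕ, d.dist (φ^[m] x) (φ^[m] y) < ε) → π x = π y)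
    (hcontr : ∀ δ > 0, ∃ K : ℕ, ∀ m ≥ K, ∀ x y, π x = π y → d.dist (φ^[m] x) (φ^[m] y) < δ)

lemma continuous_stableRuelleEquiv [TopologicalSpace Y] (hc : Continuous π) (hTc : Continuous T)
    (hT : ∀ x, ∃ U ∈ 𝓝 x, Set.InjOn T U) :
    Continuous (stableRuelleEquiv hε hπ hexp hcontr) := by
  have hinv : ∀ (n : ℤ) (x : X),
      (φ.toEquiv ^ n : Equiv.Perm X) ((φ.toEquiv ^ (-n) : Equiv.Perm X) x) = x := fun n x => by
    rw [← Equiv.Perm.mul_apply, ← zpow_add, add_neg_cancel, zpow_zero, Equiv.Perm.one_apply]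
  have hinv' : ∀ (n : ℤ) (x : X),
      (φ.toEquiv ^ (-n) : Equiv.Perm X) ((φ.toEquiv ^ n : Equiv.Perm X) x) = x := fun n x => by
    rw [← Equiv.Perm.mul_apply, ← zpow_add, neg_add_cancel, zpow_zero, Equiv.Perm.one_apply]
  let un : StableRel d φ ε × ℤ → StableRuelle d φ ε := fun q =>
    ⟨(φ.toEquiv ^ (-q.2) : Equiv.Perm X) q.1.pair.1, q.2, q.1.pair.2, by rw [hinv]; exact q.1.mem⟩
  let emb : StableRuelle d φ ε → StableRel d φ ε × ℤ := fun g => (⟨_, g.mem⟩, g.lag)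
  have hun : ∀ g, un (emb g) = g := fun g => StableRuelle.ext (hinv' _ _) rfl rfl
  have hemb : Continuous emb := continuous_induced_dom
  -- The Ruelle topology is induced by `emb`, but maps are easier to test out of the product with
  -- discrete `ℤ` and the inductive limit. The left inverse `un` of `emb` moves the question there,
  -- one lag and one level at a time.
  suffices h : Continuous (stableRuelleEquiv hε hπ hexp hcontr ∘ un) by
    convert h.comp hemb using 1
    exact funext fun g => congrArg _ (hun g).symm
  refine continuous_prod_of_discrete_right.2 fun n => continuous_iSup_dom.2 fun M =>
    continuous_coinduced_dom.2 (Continuous.subtype_mk ?_ _)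
  have h1 : Continuous fun p : {p : X × X // p ∈ stableSet d φ ∧ p ∈ stableLevel d φ ε M} =>
      (φ.toEquiv ^ (-n) : Equiv.Perm X) p.1.1 :=
    (continuous_zpow_toEquiv (-n)).comp (continuous_fst.comp continuous_subtype_val)
  have h2 : Continuous fun p : {p : X × X // p ∈ stableSet d φ ∧ p ∈ stableLevel d φ ε M} =>
      p.1.2 := continuous_snd.comp continuous_subtype_val
  refine h1.prodMk (Continuous.prodMk ?_ h2)
  refine continuous_iff_continuousAt.2 fun p => ?_
  -- These exponents depend only on the lag and the level, so the whole level maps into a single set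
  -- `T^m(x) = T^k(y)`.
  have hn : n = (((n + n.natAbs).toNat + M : ℕ) : ℤ) - (n.natAbs + M : ℕ) := by
    omega
  refine DeaconuRenault.continuousAt_of_eventually hTc hT (hc.comp h1).continuousAt
    (hc.comp h2).continuousAt (Filter.Eventually.of_forall fun p => ⟨hn, ?_⟩)
  have h3 := iterate_eq_of_mem_stableLevel hπ hexp p.2.2
  change T^[_] (π ((φ.toEquiv ^ (-n) : Equiv.Perm X) p.1.1)) = T^[_] (π p.1.2)
  rw [← iterate_proj_zpow hπ hn, hinv, Function.iterate_add_apply, h3,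
    ← Function.iterate_add_apply]

lemma continuous_stableRuelleEquiv_symm [TopologicalSpace Y] :
    Continuous (stableRuelleEquiv hε hπ hexp hcontr).symm := by
  refine continuous_induced_rng.2 (Continuous.prodMk ?_
    (DeaconuRenault.continuous_lag.comp (continuous_fst.comp
      (continuous_snd.comp continuous_subtype_val))))
  refine continuous_iff_continuousAt.2 fun p => ?_
  obtain ⟨m, k, hl, he⟩ := p.1.2.1.cond
  obtain ⟨K, hK⟩ := hcontr ε hε
  let O : Set (Amplification (DeaconuRenault.groupoid T) π) :=
    {q | q.1.2.1 ∈ DeaconuRenault.basicSet Set.univ m k Set.univ}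
  have hO : IsOpen O := (DeaconuRenault.isOpen_basicSet isOpen_univ isOpen_univ m k).preimage
    (continuous_fst.comp (continuous_snd.comp continuous_subtype_val))
  have hOp : p ∈ O := ⟨trivial, hl, trivial, he⟩
  -- On the open set `O` the exponents are fixed, hence the map factors through the level `K + k`,
  -- whose inclusion into the stable relation is continuous.
  refine ContinuousOn.continuousAt (s := O) ?_ (hO.mem_nhds hOp)
  rw [continuousOn_iff_continuous_domRestrict]
  let f : O → {p : X × X // p ∈ stableSet d φ ∧ p ∈ stableLevel d φ ε (K + k)} := fun q =>
    ⟨((φ.toEquiv ^ ((m : ℤ) - k) : Equiv.Perm X) q.1.1.1, q.1.1.2.2), by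
      have h : T^[k] (π ((φ.toEquiv ^ ((m : ℤ) - k) : Equiv.Perm X) q.1.1.1)) =
          T^[k] (π q.1.1.2.2) := by
        rw [iterate_proj_zpow hπ rfl, ← show q.1.1.2.1.rng = π q.1.1.1 from q.1.2.1,
          ← show q.1.1.2.1.src = π q.1.1.2.2 from q.1.2.2]
        exact q.2.2.2.2
      exact ⟨mem_stableSet_of_iterate_eq hπ hcontr h, mem_stableLevel_of_iterate_eq hπ hK h⟩⟩
  have hf : Continuous f := by
    refine Continuous.subtype_mk (Continuous.prodMk ((continuous_zpow_toEquiv _).comp ?_) ?_) _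
    · exact continuous_fst.comp (continuous_subtype_val.comp continuous_subtype_val)
    · exact continuous_snd.comp (continuous_snd.comp
        (continuous_subtype_val.comp continuous_subtype_val))
  have hi : Continuous fun p : {p : X × X // p ∈ stableSet d φ ∧ p ∈ stableLevel d φ ε (K + k)} =>
      (⟨p.1, p.2.1⟩ : StableRel d φ ε) :=
    continuous_iff_coinduced_le.2 (le_iSup (fun M : ℕ => TopologicalSpace.coinduced
      (fun p : {p : X × X // p ∈ stableSet d φ ∧ p ∈ stableLevel d φ ε M} =>
        (⟨p.1, p.2.1⟩ : StableRel d φ ε)) inferInstance) (K + k))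
  convert hi.comp hf using 1
  refine funext fun q => ?_
  have : q.1.1.2.1.lag = (m : ℤ) - k := q.2.2.1
  simp only [Set.domRestrict_apply, Function.comp_apply, f, StableRel.mk.injEq]
  rw [← this]
  rfl

/-- The isomorphism `(ξ, n, η) ↦ (ξ, (π(ξ), n, π(η)), η)` from the stable Ruelle groupoid to the
amplification of the Deaconu–Renault groupoid. -/
def stableRuelleIso [TopologicalSpace Y] (hc : Continuous π) (hTc : Continuous T)
    (hT : ∀ x, ∃ U ∈ 𝓝 x, Set.InjOn T U) :
    TopGroupoidIso (StableRuelle.groupoid d φ ε) ((DeaconuRenault.groupoid T).amplify π) where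
  onArrows :=
    { stableRuelleEquiv hε hπ hexp hcontr with
      continuous_toFun := continuous_stableRuelleEquiv hε hπ hexp hcontr hc hTc hT
      continuous_invFun := continuous_stableRuelleEquiv_symm hε hπ hexp hcontr }
  onUnits := Homeomorph.refl X
  map_r _ := rfl
  map_s _ := rfl
  map_mul _ _ _ := rfl

include hε hπ hexp hcontr in
lemma isTopological_stableRuelle [TopologicalSpace Y] (hc : Continuous π) (hTc : Continuous T)
    (hT : ∀ x, ∃ U ∈ 𝓝 x, Set.InjOn T U) : (StableRuelle.groupoid d φ ε).IsTopological :=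
  ((DeaconuRenault.isTopological_groupoid hTc hT).amplify hc).of_iso
    (stableRuelleIso hε hπ hexp hcontr hc hTc hT) (fun _ => rfl) fun _ => rfl

end

end Extension

/-! ### The main theorem. -/

theorem mainTheorem4 {V : Type u} {A : Type v} [Finite V] [Finite A] (E : DirGraph V A)
    (hsinks : E.NoSinks) (hsources : E.NoSources) [CategoryTheory.Groupoid.{w} V]
    (S : SelfSimilarAction E) (hcontr : S.Contracting) (hreg : S.Regular) :
    -- the spaces and maps are as the constructions of the two groupoids require
    (CompactSpace S.LimitSpace ∧ TopologicalSpace.MetrizableSpace S.LimitSpace ∧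
      CompactSpace S.Solenoid ∧ TopologicalSpace.MetrizableSpace S.Solenoid ∧
      IsLocalHomeomorph S.shiftJ ∧
      Continuous S.proj ∧ IsOpenMap S.proj ∧ Function.Surjective S.proj ∧
      (S.dualGroupoid.amplify S.proj).IsTopological) ∧
    -- the isomorphism, for every metric on the solenoid that induces its topology
    ∀ d : CompatibleMetric S.Solenoid,
      ∃ ε₀ : ℝ, 0 < ε₀ ∧ ∀ ε : ℝ, 0 < ε → ε ≤ ε₀ →
        stableSet d S.tau = ⋃ M : ℕ, stableLevel d S.tau ε M ∧
        (StableRuelle.groupoid d S.tau ε).IsTopological ∧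
        ∃ κ : TopGroupoidIso (StableRuelle.groupoid d S.tau ε) (S.dualGroupoid.amplify S.proj),
          ∀ g : StableRuelle d S.tau ε,
            (κ.onArrows g).1.1 = g.rng ∧
            (κ.onArrows g).1.2.1.rng = S.proj g.rng ∧
            (κ.onArrows g).1.2.1.lag = g.lag ∧
            (κ.onArrows g).1.2.1.src = S.proj g.src ∧
            (κ.onArrows g).1.2.2 = g.src := by
  obtain ⟨N, hN⟩ := hcontr.exists_isNucleus
  have := hN.t2Space_limitSpace
  have := hN.secondCountableTopology_limitSpace
  have := hN.t2Space_solenoid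
  have := hN.secondCountableTopology_solenoid
  obtain ⟨O, hO, hexp⟩ := hN.exists_expansive hreg
  have hσ : Continuous S.shiftJ := SelfSimilarAction.continuous_shiftJ
  have hπ : Continuous S.proj := SelfSimilarAction.continuous_proj
  have hinj : ∀ x, ∃ U ∈ 𝓝 x, Set.InjOn S.shiftJ U := by
    intro x
    obtain ⟨U, hU, W, hW, hUW⟩ := mem_nhds_prod_iff.1 (hO x)
    -- Expansivity gives local injectivity: if `y` and `z` have the same image, then all later
    -- iterates coincide and only time `0` needs the neighbourhood.
    refine ⟨U ∩ W, Filter.inter_mem hU hW, fun y hy z hz hyz => hexp y z fun m => ?_⟩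
    cases m with
    | zero => exact hUW ⟨hy.1, hz.2⟩
    | succ m =>
      rw [Function.iterate_succ_apply, Function.iterate_succ_apply, hyz]
      exact mem_of_mem_nhds (hO _)
  refine ⟨⟨inferInstance, inferInstance, inferInstance, inferInstance,
    isLocalHomeomorph_of_isOpenMap hσ hN.isOpenMap_shiftJ hinj, hπ, hN.isOpenMap_proj,
    SelfSimilarAction.surjective_proj hsources,
    (DeaconuRenault.isTopological_groupoid hσ hinj).amplify hπ⟩, fun d => ?_⟩
  -- The threshold `ε₀` is a Lebesgue number for the expansivity neighbourhood `O`, pulled back to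
  -- the solenoid; this is the only constraint on `ε`.
  obtain ⟨ε₀, hε₀, hd⟩ := d.exists_forall_dist_lt
    (W := (fun p : S.Solenoid × S.Solenoid => (S.proj p.1, S.proj p.2)) ⁻¹' O) fun ξ =>
      ((hπ.comp continuous_fst).prodMk (hπ.comp continuous_snd)).continuousAt (hO (S.proj ξ))
  refine ⟨ε₀, hε₀, fun ε hε hεε₀ => ?_⟩
  have hexp' : ∀ ξ η, (∀ m : ℕ, d.dist (S.tau^[m] ξ) (S.tau^[m] η) < ε) →
      S.proj ξ = S.proj η := by
    refine fun ξ η h => hexp _ _ fun m => ?_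
    have hs := (show Function.Semiconj S.proj S.tau S.shiftJ from
      SelfSimilarAction.proj_tau).iterate_right m
    rw [← hs, ← hs]
    exact hd _ _ ((h m).trans_le hεε₀)
  have hcon : ∀ δ > 0, ∃ K : ℕ, ∀ m ≥ K, ∀ ξ η, S.proj ξ = S.proj η →
      d.dist (S.tau^[m] ξ) (S.tau^[m] η) < δ := fun δ hδ =>
    exists_forall_iterate_mem hπ SelfSimilarAction.proj_tau
      (fun _ _ h => hN.eq_of_proj_symm_iterate h) (isOpen_Iio.preimage d.continuous_dist)
      fun ξ => by simpa [d.dist_self] using hδ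
  refine ⟨stableSet_eq_iUnion_stableLevel hε SelfSimilarAction.proj_tau hexp' hcon,
    isTopological_stableRuelle hε SelfSimilarAction.proj_tau hexp' hcon hπ hσ hinj,
    stableRuelleIso hε SelfSimilarAction.proj_tau hexp' hcon hπ hσ hinj,
    fun g => ⟨rfl, rfl, rfl, rfl, rfl⟩⟩
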